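/- **Setting (bandits with concave rewards and convex knapsacks, BwCR).** There are $m\ge 1$ arms, a dimension $d\ge 1$ and a horizon $T\ge 1$. Each arm $i$ has an unknown distribution on $[0,1]^d$ with mean $V_i$; let $V\in[0,1]^{d\times m}$ be the matrix with columns $V_i$. When arm $i_t$ is played at time $t$, a vector $v_t\in[0,1]^d$ is drawn from the distribution of arm $i_t$, independently of the past, and observed. Given are a convex set $S\subseteq\mathbb R^d$ and a concave $f:[0,1]^d\to[0,1]$ with $f(x)-f(y)\le L\|x-y\|$, where $\|\cdot\|$ is an $L_q$ norm ($1\le q\le\infty$); $d(x,S)$ denotes the distance to $S$ in an $L_{q'}$ norm $\|\cdot\|'$ (possibly the same). Let $\Delta_m$ be the simplex of distributions over arms, and assume that some $p\in\Delta_m$ has $Vp\in S$. Let $\mathrm{OPT}_f$ be the supremum of $\mathbb E\, f(\frac1T\sum_{t=1}^T v_t)$ over all dynamic (non-anticipating, possibly randomized) policies with $\frac1T\sum_{t=1}^T v_t\in S$ almost surely ($0$ if there is no such policy). The average regrets of an algorithm are $$\mathrm{areg}_1(T)=\mathrm{OPT}_f-f\Big(\frac1T\sum_{t=1}^T v_t\Big),\qquad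 \mathrm{areg}_2(T)=d\Big(\frac1T\sum_{t=1}^T v_t,\;S\Big).$$ **UCB algorithm with parameter $\gamma$.** Let $\mathrm{rad}(\nu,N)=\sqrt{\gamma\nu/N}+\gamma/N$, let $k_{t,i}$ be the number of plays of arm $i$ before time $t$, and let $\hat V_{t,ji}=\frac{1}{k_{t,i}+1}\sum_{s<t:\,i_s=i}v_{s,j}$. Put $$\mathrm{UCB}_{t,ji}=\min\{1,\hat V_{t,ji}+2\,\mathrm{rad}(\hat V_{t,ji},k_{t,i}+1)\},\qquad \mathrm{LCB}_{t,ji}=\max\{0,\hat V_{t,ji}-2\,\mathrm{rad}(\hat V_{t,ji},k_{t,i}+1)\},$$ and $H_t=\{\tilde V\in\mathbb R^{d\times m}:\tilde V_{ji}\in[\mathrm{LCB}_{t,ji},\mathrm{UCB}_{t,ji}]\ \text{for all } i,j\}$. At each time $t=1,\dots,T$ the algorithm takes $$p_t\in\arg\max_{p\in\Delta_m}\ \max_{\tilde U\in H_t}f(\tilde Up)\quad\text{subject to}\quad \min_{\tilde V\in H_t}d(\tilde Vp,S)\le 0$$ ($p_t\in\Delta_m$ is arbitrary if this problem is infeasible)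 and plays arm $i$ with probability $p_{t,i}$. **Theorem.** There are absolute constants $c,C>0$ such that, for all such problems and all $\delta\in(0,1)$ with $2\delta\le mTd$ (a condition only if $m=T=d=1$), every execution of the UCB algorithm with $\gamma=c\log(mTd/\delta)$ satisfies, with probability at least $1-\delta$, simultaneously $$\mathrm{areg}_1(T)\le C\,L\,\|\mathbf 1_d\|\sqrt{\frac{\gamma m}{T}},\qquad \mathrm{areg}_2(T)\le C\,\|\mathbf 1_d\|'\sqrt{\frac{\gamma m}{T}},$$ where $\mathbf 1_d\in\mathbb R^d$ is the all-ones vector. On the same event the first bound also holds with $\mathrm{OPT}_f$ replaced by $f(Vp)$, for every $p\in\Delta_m$ with $Vp\in S$. -/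

import Mathlib

open MeasureTheory
open scoped ENNReal

noncomputable section

namespace BwCR

/-- An observation: a vector in `[0,1]^d`. -/
abbrev Obs (d : ℕ) : Type := Fin d → unitInterval

/-- A history of `t` rounds: the arm played and the vector observed in each round. -/
abbrev History (m d t : ℕ) : Type := Fin t → Fin m × Obs d

/-- The cube `[0,1]^d` inside `ℝ^d`, the domain of the objective. -/
def cube (d : ℕ) : Set (Fin d → ℝ) := Set.Icc 0 1

/-- The `L_q` norm on `ℝ^d`, for `1 ≤ q ≤ ∞`. -/
def lqNorm (q : ℝ≥0∞) {d : ℕ} (x : Fin d → ℝ) : ℝ := ‖WithLp.toLp q x‖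

/-- The `L_q` distance from the point `x` to the set `S`. -/
def lqDist (q : ℝ≥0∞) [Fact (1 ≤ q)] {d : ℕ} (x : Fin d → ℝ) (S : Set (Fin d → ℝ)) : ℝ :=
  Metric.infDist (WithLp.toLp q x) (WithLp.toLp q '' S)

/-- A dynamic (adaptive, possibly randomized) policy: from the history of the first `t` rounds it
computes the distribution over the `m` arms from which the next arm is drawn. -/
structure Policy (m d : ℕ) where
  /-- The distribution over arms used after a given history. -/
  dist : (t : ℕ) → History m d t → (Fin m → ℝ)
  mem_simplex : ∀ t h, dist t h ∈ stdSimplex ℝ (Fin m)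
  measurable_dist : ∀ t, Measurable (dist t)

variable {m d : ℕ}

/-- The law of the history of the first `t` rounds when policy `π` is run and the observations of
arm `i` are drawn from `D i`. In each round, given the history `h`, arm `i` is played with
probability `π.dist t h i`, and then the observation `x` is drawn from `D i`, independently of
the past; the history `h` is extended by `(i, x)`. -/
def histLaw (D : Fin m → Measure (Obs d)) (π : Policy m d) : (t : ℕ) → Measure (History m d t)
  | 0 => Measure.dirac (fun s => Fin.elim0 s)
  | t + 1 => ∑ i : Fin m,
      (((histLaw D π t).withDensity (fun h => ENNReal.ofReal (π.dist t h i))).prod (D i)).map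
        (fun z => (Fin.snoc z.1 (i, z.2) : History m d (t + 1)))

/-- The average observed vector `(1/T) ∑ₜ vₜ` of a history of `T` rounds. -/
def avgObs {T : ℕ} (h : History m d T) : Fin d → ℝ :=
  fun j => (∑ s, ((h s).2 j : ℝ)) / T

/-- The `d × m` matrix `V` of the means: `V j i` is the mean of component `j` of arm `i`. -/
def meanMatrix (D : Fin m → Measure (Obs d)) : Matrix (Fin d) (Fin m) ℝ :=
  fun j i => ∫ x, (x j : ℝ) ∂(D i)

/-- `OPT_f`: the optimal expected objective value `𝔼 f((1/T) ∑ₜ vₜ)` over all dynamic policies whose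
average observed vector lies in `S` almost surely. The values of `f` are in `[0,1]`, so the set is
bounded; if there is no such policy then the value is `0`, the least possible one. -/
def optValue (D : Fin m → Measure (Obs d)) (f : (Fin d → ℝ) → ℝ) (S : Set (Fin d → ℝ)) (T : ℕ) :
    ℝ :=
  sSup {r | ∃ π : Policy m d, (∀ᵐ h ∂(histLaw D π T), avgObs h ∈ S) ∧
    r = ∫ h, f (avgObs h) ∂(histLaw D π T)}

/-- The average regret in the objective, on the realized history `h`. -/
def regretObj (D : Fin m → Measure (Obs d)) (f : (Fin d → ℝ) → ℝ) (S : Set (Fin d → ℝ)) {T : ℕ}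
    (h : History m d T) : ℝ :=
  optValue D f S T - f (avgObs h)

/-- The average regret in the constraints, on the realized history `h`. -/
def regretCon (q : ℝ≥0∞) [Fact (1 ≤ q)] (S : Set (Fin d → ℝ)) {T : ℕ} (h : History m d T) : ℝ :=
  lqDist q (avgObs h) S

/-- The number of plays of arm `i` in the history `h`. -/
def plays {t : ℕ} (h : History m d t) (i : Fin m) : ℕ :=
  (Finset.univ.filter (fun s => (h s).1 = i)).card

/-- The empirical average of component `j` of arm `i`, with denominator `plays + 1`. -/
def empMean {t : ℕ} (h : History m d t) (j : Fin d) (i : Fin m) : ℝ :=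
  (∑ s ∈ Finset.univ.filter (fun s => (h s).1 = i), ((h s).2 j : ℝ)) / (plays h i + 1)

/-- The confidence radius. -/
def rad (γ ν N : ℝ) : ℝ := Real.sqrt (γ * ν / N) + γ / N

/-- The upper confidence bounds. -/
def ucb (γ : ℝ) {t : ℕ} (h : History m d t) (j : Fin d) (i : Fin m) : ℝ :=
  min 1 (empMean h j i + 2 * rad γ (empMean h j i) (plays h i + 1))

/-- The lower confidence bounds. -/
def lcb (γ : ℝ) {t : ℕ} (h : History m d t) (j : Fin d) (i : Fin m) : ℝ :=
  max 0 (empMean h j i - 2 * rad γ (empMean h j i) (plays h i + 1))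

/-- The confidence hypercube `H_t` computed from the history `h`. -/
def confCube (γ : ℝ) {t : ℕ} (h : History m d t) : Set (Matrix (Fin d) (Fin m) ℝ) :=
  {V | ∀ j i, V j i ∈ Set.Icc (lcb γ h j i) (ucb γ h j i)}

/-- The distributions `p` over arms with `min_{V ∈ H_t} d(V p, S) ≤ 0`. The hypercube is compact and
the distance is continuous, so the minimum is attained and the constraint says that some
`V ∈ H_t` has `d(V p, S) ≤ 0`. -/
def feasible (q : ℝ≥0∞) [Fact (1 ≤ q)] (γ : ℝ) (S : Set (Fin d → ℝ)) {t : ℕ} (h : History m d t) :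
    Set (Fin m → ℝ) :=
  {p | p ∈ stdSimplex ℝ (Fin m) ∧ ∃ V ∈ confCube γ h, lqDist q (V.mulVec p) S ≤ 0}

/-- `p` maximizes `max_{U ∈ H_t} f(U p)` over the feasible distributions: `p` is feasible, and some
`U ∈ H_t` gives `p` a value that no feasible `p'` exceeds with any `U' ∈ H_t`. -/
def IsOptimalChoice (q : ℝ≥0∞) [Fact (1 ≤ q)] (γ : ℝ) (f : (Fin d → ℝ) → ℝ) (S : Set (Fin d → ℝ))
    {t : ℕ} (h : History m d t) (p : Fin m → ℝ) : Prop :=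
  p ∈ feasible q γ S h ∧ ∃ U ∈ confCube γ h,
    ∀ p' ∈ feasible q γ S h, ∀ U' ∈ confCube γ h, f (U'.mulVec p') ≤ f (U.mulVec p)

/-- `π` is an execution of the UCB algorithm over the horizon `T` with parameter `γ`: after every
history of fewer than `T` rounds it uses an optimal solution of the optimization problem over the
confidence hypercube if that problem is feasible, and an arbitrary distribution otherwise. -/
def IsUCBPolicy (q : ℝ≥0∞) [Fact (1 ≤ q)] (γ : ℝ) (f : (Fin d → ℝ) → ℝ) (S : Set (Fin d → ℝ))
    (T : ℕ) (π : Policy m d) : Prop :=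
  ∀ t < T, ∀ h : History m d t, (feasible q γ S h).Nonempty →
    IsOptimalChoice q γ f S h (π.dist t h)

end BwCR

end

/-! The argument is optimism in the face of uncertainty. Suppose that the mean matrix `V` lies in
the confidence cube of every round. Then every `p` with `V p ∈ closure S` is feasible in every
round, so the distribution `p_t` played comes with matrices `U_t`, `V_t` of the cube such that `f
(U_t p_t) ≥ f (V p)` and `V_t p_t ∈ closure S`. Averaging over `t`, concavity of `f` and convexity
of `S` carry both properties over to the averages of `U_t p_t` and of `V_t p_t`.

It remains to compare such averages with the average observation, coordinate by coordinate
(`abs_sum_mulVec_sub_obs_le`). Replacing `U_t` by `V` costs the expected width of the confidence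
intervals under `p_t`; a martingale bound exchanges it for the width of the arm played, and these
widths sum to at most `16 √(γ m T)`. A second martingale bound replaces `V p_t` by the observed
vector. The total is `(2 + 16 + 2) √(γ m T)`, hence `C = 20`.

The probabilistic input is one supermartingale estimate for sums along the history
(`histLaw_le_pathSum_le`), used for the martingales (`histLaw_azuma`) and for the confidence
intervals (`histLaw_notMem_Icc_lcb_ucb_le`). By Jensen's inequality, `optValue_le` reduces `OPT_f`
to the values `f (V p)` with `V p ∈ closure S`. -/

noncomputable section

namespace BwCR

/-! ### Sums along a history, and Chernoff's bound for them. -/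

section

variable {m d : ℕ}

/-- The history of the first `t` rounds of a history of `T` rounds. -/
def initialPart {T : ℕ} (t : ℕ) (ht : t ≤ T) (h : History m d T) : History m d t :=
  fun s => h (Fin.castLE ht s)

/-- The history `h` extended by one more round. -/
def extend {t : ℕ} (h : History m d t) (i : Fin m) (x : Obs d) : History m d (t + 1) :=
  Fin.snoc (α := fun _ => Fin m × Obs d) h (i, x)

/-- The sum over the rounds of a history of a quantity that depends on the past, on the arm played
and on the vector observed. -/
def pathSum (g : (t : ℕ) → History m d t → Fin m → Obs d → ℝ) {t : ℕ} (h : History m d t) : ℝ :=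
  ∑ s : Fin t, g s (initialPart s s.isLt.le h) (h s).1 (h s).2

@[simp]
lemma extend_castSucc {t : ℕ} (h : History m d t) (i : Fin m) (x : Obs d) (s : Fin t) :
    extend h i x s.castSucc = h s := by
  simp [extend]

@[simp]
lemma extend_last {t : ℕ} (h : History m d t) (i : Fin m) (x : Obs d) :
    extend h i x (Fin.last t) = (i, x) := by
  simp [extend]

lemma initialPart_extend {T t : ℕ} (ht : t ≤ T) (h : History m d T) (i : Fin m) (x : Obs d) :
    initialPart t (ht.trans T.le_succ) (extend h i x) = initialPart t ht h := by
  funext s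
  exact extend_castSucc h i x (Fin.castLE ht s)

lemma pathSum_extend (g : (t : ℕ) → History m d t → Fin m → Obs d → ℝ) {t : ℕ}
    (h : History m d t) (i : Fin m) (x : Obs d) :
    pathSum g (extend h i x) = pathSum g h + g t h i x := by
  unfold pathSum
  rw [Fin.sum_univ_castSucc]
  congr 1
  · refine Finset.sum_congr rfl fun s _ => ?_
    have := initialPart_extend s.isLt.le h i x
    simp only [extend_castSucc, Fin.val_castSucc]
    rw [this]
  · have : initialPart t t.le_succ (extend h i x) = h := by
      rw [initialPart_extend le_rfl]; rfl
    simp only [extend_last, Fin.val_last]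
    rw [this]

@[fun_prop]
lemma measurable_initialPart {T t : ℕ} (ht : t ≤ T) :
    Measurable (initialPart t ht : History m d T → History m d t) := by
  unfold initialPart
  fun_prop

lemma measurable_extend {t : ℕ} (i : Fin m) :
    Measurable (fun z : History m d t × Obs d => extend z.1 i z.2) := by
  refine measurable_pi_lambda _ fun s => ?_
  induction s using Fin.lastCases with
  | last => simp only [extend_last]; fun_prop
  | cast s => simp only [extend_castSucc]; fun_prop

lemma measurable_pathSum {g : (t : ℕ) → History m d t → Fin m → Obs d → ℝ}
    (hg : ∀ t i, Measurable (fun z : History m d t × Obs d => g t z.1 i z.2)) (t : ℕ) :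
    Measurable (fun h : History m d t => pathSum g h) := by
  unfold pathSum
  refine Finset.measurable_sum _ fun s _ => ?_
  have hj : Measurable
      (fun z : (History m d s × Obs d) × Fin m => g s z.1.1 z.2 z.1.2) :=
    measurable_from_prod_countable_left fun i => hg s i
  exact hj.comp (f := fun h : History m d t =>
    ((initialPart s s.isLt.le h, (h s).2), (h s).1)) (by fun_prop)

variable (D : Fin m → Measure (Obs d)) [∀ i, IsProbabilityMeasure (D i)] (π : Policy m d)

/-- Disintegration over the last round. It is stated for the Lebesgue integral of nonnegative
functions, so that inductions on the number of rounds need no integrability. -/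
lemma lintegral_histLaw_succ {t : ℕ} {F : History m d (t + 1) → ℝ≥0∞} (hF : Measurable F) :
    ∫⁻ h, F h ∂(histLaw D π (t + 1)) =
      ∫⁻ h, ∑ i, ENNReal.ofReal (π.dist t h i) * ∫⁻ x, F (extend h i x) ∂(D i)
        ∂(histLaw D π t) := by
  have hd : ∀ i, Measurable fun h => ENNReal.ofReal (π.dist t h i) := fun i =>
    ((measurable_pi_apply i).comp (π.measurable_dist t)).ennreal_ofReal
  have hFe : ∀ i, Measurable fun z : History m d t × Obs d => F (extend z.1 i z.2) :=
    fun i => hF.comp (measurable_extend i)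
  have hp : ∀ i, Measurable fun h : History m d t =>
      ENNReal.ofReal (π.dist t h i) * ∫⁻ x, F (extend h i x) ∂(D i) := fun i =>
    (hd i).mul (hFe i).lintegral_prod_right'
  rw [lintegral_finsetSum _ fun i _ => hp i, histLaw, lintegral_finsetSum_measure]
  refine Finset.sum_congr rfl fun i _ => ?_
  refine (lintegral_map hF (measurable_extend i)).trans ?_
  rw [lintegral_prod _ (hFe i).aemeasurable,
    lintegral_withDensity_eq_lintegral_mul _ (hd i) (hFe i).lintegral_prod_right']
  rfl

lemma sum_ofReal_dist {t : ℕ} (h : History m d t) :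
    ∑ i, ENNReal.ofReal (π.dist t h i) = 1 := by
  rw [← ENNReal.ofReal_sum_of_nonneg fun i _ => (π.mem_simplex t h).1 i, (π.mem_simplex t h).2,
    ENNReal.ofReal_one]

/-- Consistency of the laws: a further round has total mass one. All events can therefore be
measured under the law of the full horizon. -/
lemma lintegral_histLaw_initialPart {t T : ℕ} (ht : t ≤ T) {F : History m d t → ℝ≥0∞}
    (hF : Measurable F) :
    ∫⁻ h, F (initialPart t ht h) ∂(histLaw D π T) = ∫⁻ h, F h ∂(histLaw D π t) := by
  induction T, ht using Nat.le_induction with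
  | base => rfl
  | succ T hT ih =>
    rw [lintegral_histLaw_succ D π (F := fun h => F (initialPart t _ h))
      (hF.comp (measurable_initialPart _)), ← ih]
    simp only [initialPart_extend hT, lintegral_const, measure_univ, mul_one, ← Finset.sum_mul,
      sum_ofReal_dist, one_mul]

instance isProbabilityMeasure_histLaw (t : ℕ) : IsProbabilityMeasure (histLaw D π t) := by
  refine ⟨?_⟩
  have h := lintegral_histLaw_initialPart D π t.zero_le (F := fun _ => 1) measurable_const
  simpa [histLaw] using h

/-- A path sum whose increments have conditional exponential moment at most `1` has exponential
moment at most `1`. -/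
lemma lintegral_exp_pathSum_le_one {g : (t : ℕ) → History m d t → Fin m → Obs d → ℝ}
    (hg : ∀ t i, Measurable (fun z : History m d t × Obs d => g t z.1 i z.2))
    (hstep : ∀ t h, ∑ i, ENNReal.ofReal (π.dist t h i) *
      ∫⁻ x, ENNReal.ofReal (Real.exp (g t h i x)) ∂(D i) ≤ 1) (t : ℕ) :
    ∫⁻ h, ENNReal.ofReal (Real.exp (pathSum g h)) ∂(histLaw D π t) ≤ 1 := by
  induction t with
  | zero => simp [histLaw, pathSum]
  | succ t ih =>
    rw [lintegral_histLaw_succ D π (measurable_pathSum hg _).exp.ennreal_ofReal]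
    refine (lintegral_mono fun h => ?_).trans ih
    have hx : ∀ i x, ENNReal.ofReal (Real.exp (pathSum g (extend h i x))) =
        ENNReal.ofReal (Real.exp (pathSum g h)) * ENNReal.ofReal (Real.exp (g t h i x)) := by
      intro i x
      rw [pathSum_extend, Real.exp_add, ENNReal.ofReal_mul (Real.exp_pos _).le]
    simp only [hx]
    have hi : ∀ i, ∫⁻ x, ENNReal.ofReal (Real.exp (pathSum g h)) *
        ENNReal.ofReal (Real.exp (g t h i x)) ∂(D i) = ENNReal.ofReal (Real.exp (pathSum g h)) *
        ∫⁻ x, ENNReal.ofReal (Real.exp (g t h i x)) ∂(D i) := fun i =>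
      lintegral_const_mul' _ _ ENNReal.ofReal_ne_top
    simp only [hi, mul_left_comm _ (ENNReal.ofReal (Real.exp (pathSum g h))), ← Finset.mul_sum]
    exact mul_le_of_le_one_right' (hstep t h)

/-- Chernoff's bound for a path sum over the first `t` of `T` rounds. -/
lemma histLaw_le_pathSum_le {g : (t : ℕ) → History m d t → Fin m → Obs d → ℝ}
    (hg : ∀ t i, Measurable (fun z : History m d t × Obs d => g t z.1 i z.2))
    (hstep : ∀ t h, ∑ i, ENNReal.ofReal (π.dist t h i) *
      ∫⁻ x, ENNReal.ofReal (Real.exp (g t h i x)) ∂(D i) ≤ 1) {t T : ℕ} (ht : t ≤ T) (a : ℝ) :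
    histLaw D π T {h | a ≤ pathSum g (initialPart t ht h)} ≤ ENNReal.ofReal (Real.exp (-a)) := by
  have hm := (measurable_pathSum hg t).exp.ennreal_ofReal
  have h1 := mul_meas_ge_le_lintegral (μ := histLaw D π T) (hm.comp (measurable_initialPart ht))
    (ENNReal.ofReal (Real.exp a))
  have h2 := (h1.trans_eq (lintegral_histLaw_initialPart D π ht hm)).trans
    (lintegral_exp_pathSum_le_one D π hg hstep t)
  rw [Real.exp_neg, ENNReal.ofReal_inv_of_pos (Real.exp_pos _)]
  rw [ENNReal.le_inv_iff_mul_le, mul_comm]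
  refine le_trans ?_ h2
  gcongr
  intro hh
  exact ENNReal.ofReal_le_ofReal (Real.exp_le_exp.2 (by assumption))

end

/-! ### Exponential moments, Azuma's inequality, and coverage of the confidence intervals. -/

section

variable {m d : ℕ}

lemma lintegral_exp_le {X : Type*} [MeasurableSpace X] (ν : Measure X) [IsProbabilityMeasure ν]
    {Y : X → ℝ} (hY : Measurable Y) (hY1 : ∀ x, |Y x| ≤ 1) :
    ∫⁻ x, ENNReal.ofReal (Real.exp (Y x)) ∂ν ≤
      ENNReal.ofReal (1 + ∫ x, Y x ∂ν + ∫ x, Y x ^ 2 ∂ν) := by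
  have hi1 : Integrable Y ν := Integrable.of_bound hY.aestronglyMeasurable 1
    (Filter.Eventually.of_forall hY1)
  have hi2 : Integrable (fun x => Y x ^ 2) ν :=
    Integrable.of_bound (hY.pow_const 2).aestronglyMeasurable 1
      (Filter.Eventually.of_forall fun x => by
        rw [Real.norm_eq_abs, abs_pow]; exact pow_le_one₀ (abs_nonneg _) (hY1 x))
  have hi3 : Integrable (fun x => 1 + Y x + Y x ^ 2) ν := ((integrable_const 1).add hi1).add hi2
  have hle : ∀ x, Real.exp (Y x) ≤ 1 + Y x + Y x ^ 2 := fun x => by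
    have := (abs_le.1 (Real.abs_exp_sub_one_sub_id_le (hY1 x))).2
    linarith
  have heq : ∫ x, (1 + Y x + Y x ^ 2) ∂ν = 1 + ∫ x, Y x ∂ν + ∫ x, Y x ^ 2 ∂ν := by
    rw [integral_add (f := fun x => 1 + Y x) ((integrable_const 1).add hi1) hi2,
      integral_add (integrable_const 1) hi1]
    simp
  rw [← heq, ofReal_integral_eq_lintegral_ofReal hi3
    (Filter.Eventually.of_forall fun x => (Real.exp_pos _).le.trans (hle x))]
  exact lintegral_mono fun x => ENNReal.ofReal_le_ofReal (hle x)

lemma coe_obs_mem (x : Obs d) (j : Fin d) : 0 ≤ (x j : ℝ) ∧ (x j : ℝ) ≤ 1 := (x j).2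

lemma measurable_obs (j : Fin d) : Measurable fun x : Obs d => (x j : ℝ) :=
  measurable_subtype_coe.comp (measurable_pi_apply j)

lemma integrable_obs (ν : Measure (Obs d)) [IsProbabilityMeasure ν] (j : Fin d) :
    Integrable (fun x : Obs d => (x j : ℝ)) ν :=
  Integrable.of_bound (measurable_obs j).aestronglyMeasurable 1
    (Filter.Eventually.of_forall fun x => by
      rw [Real.norm_eq_abs, abs_of_nonneg (coe_obs_mem x j).1]; exact (coe_obs_mem x j).2)

lemma meanMatrix_nonneg (D : Fin m → Measure (Obs d)) (j : Fin d) (i : Fin m) : 0 ≤ meanMatrix D j i :=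
  integral_nonneg fun x => (coe_obs_mem x j).1

variable (D : Fin m → Measure (Obs d)) [∀ i, IsProbabilityMeasure (D i)] (π : Policy m d)

lemma meanMatrix_le_one (j : Fin d) (i : Fin m) : meanMatrix D j i ≤ 1 := by
  have := integral_mono (integrable_obs (D i) j) (integrable_const (1 : ℝ))
    fun x => (coe_obs_mem x j).2
  simpa [meanMatrix] using this

/-- A Bernstein-type bound: as `x j ∈ [0,1]`, the second moment is at most the mean, so `e^y ≤ 1 + y
+ y²` on `[-1,1]` leaves only the mean in the exponent. This is what permits a radius of order
`√(γν/N)`. -/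
lemma lintegral_exp_obs_le_one (j : Fin d) (i : Fin m) {r : ℝ} (hr : |r| ≤ 1) :
    ∫⁻ x, ENNReal.ofReal (Real.exp (r * x j - (r + r ^ 2) * meanMatrix D j i)) ∂(D i) ≤ 1 := by
  set K := (r + r ^ 2) * meanMatrix D j i with hK
  have h1 := lintegral_exp_le (D i) ((measurable_obs j).const_mul r) fun x => by
    rw [abs_mul, abs_of_nonneg (coe_obs_mem x j).1]
    exact mul_le_one₀ hr (coe_obs_mem x j).1 (coe_obs_mem x j).2
  have hsq : ∫ x : Obs d, (r * (x j : ℝ)) ^ 2 ∂(D i) ≤ r ^ 2 * meanMatrix D j i := by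
    rw [meanMatrix, ← integral_const_mul]
    refine integral_mono_of_nonneg (Filter.Eventually.of_forall fun x => sq_nonneg _)
      ((integrable_obs (D i) j).const_mul _) (Filter.Eventually.of_forall fun x => ?_)
    have := coe_obs_mem x j
    simp only [mul_pow]
    gcongr
    nlinarith
  have hmul : ∀ x : Obs d, ENNReal.ofReal (Real.exp (r * x j - K)) =
      ENNReal.ofReal (Real.exp (-K)) * ENNReal.ofReal (Real.exp (r * x j)) := fun x => by
    rw [← ENNReal.ofReal_mul (Real.exp_pos _).le, ← Real.exp_add]; ring_nf
  simp only [hmul]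
  rw [lintegral_const_mul' _ _ ENNReal.ofReal_ne_top]
  refine (mul_le_mul_right h1 _).trans ?_
  rw [← ENNReal.ofReal_mul (Real.exp_pos _).le, ← ENNReal.ofReal_one]
  refine ENNReal.ofReal_le_ofReal ?_
  rw [integral_const_mul]
  have h2 : 1 + r * ∫ x : Obs d, (x j : ℝ) ∂(D i) + ∫ x : Obs d, (r * (x j : ℝ)) ^ 2 ∂(D i)
      ≤ Real.exp K := by
    refine le_trans ?_ (Real.add_one_le_exp K)
    have : meanMatrix D j i = ∫ x : Obs d, (x j : ℝ) ∂(D i) := rfl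
    rw [← this]
    linarith
  calc _ ≤ Real.exp (-K) * Real.exp K := by gcongr
    _ = 1 := by rw [← Real.exp_add]; simp

/-- The Azuma–Hoeffding bound for a supermartingale with increments in `[-1, 1]`. -/
lemma histLaw_azuma {ξ : (t : ℕ) → History m d t → Fin m → Obs d → ℝ}
    (hm : ∀ t i, Measurable (fun z : History m d t × Obs d => ξ t z.1 i z.2))
    (hb : ∀ t h i x, |ξ t h i x| ≤ 1)
    (hξ : ∀ t h, ∑ i, π.dist t h i * ∫ x, ξ t h i x ∂(D i) ≤ 0)
    {γ : ℝ} (hγ : 0 ≤ γ) {T : ℕ} (hγT : γ ≤ T) (hT : 0 < T) :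
    histLaw D π T {h | 2 * Real.sqrt (γ * T) < pathSum ξ h} ≤
      ENNReal.ofReal (Real.exp (-γ)) := by
  have hT' : (0 : ℝ) < T := by exact_mod_cast hT
  -- The compensator `r²` per round adds up to `γ`, while a sum above `2 √(γT)` contributes more
  -- than `2γ`. The assumption `γ ≤ T` gives `r ≤ 1`, as the exponential estimate requires.
  set r := Real.sqrt (γ / T) with hr
  have hr0 : 0 ≤ r := Real.sqrt_nonneg _
  have hr1 : r ≤ 1 := Real.sqrt_le_one.2 ((div_le_one hT').2 hγT)
  have hr2 : r ^ 2 = γ / T := Real.sq_sqrt (by positivity)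
  have hstep : ∀ t h, ∑ i, ENNReal.ofReal (π.dist t h i) *
      ∫⁻ x, ENNReal.ofReal (Real.exp (r * ξ t h i x - r ^ 2)) ∂(D i) ≤ 1 := by
    intro t h
    have hmi : ∀ i, Measurable (ξ t h i) := fun i => (hm t i).comp measurable_prodMk_left
    have hi : ∀ i, ∫⁻ x, ENNReal.ofReal (Real.exp (r * ξ t h i x - r ^ 2)) ∂(D i) ≤
        ENNReal.ofReal (Real.exp (-r ^ 2) * (1 + r * ∫ x, ξ t h i x ∂(D i) + r ^ 2)) := by
      intro i
      have hmul : ∀ x : Obs d, ENNReal.ofReal (Real.exp (r * ξ t h i x - r ^ 2)) =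
          ENNReal.ofReal (Real.exp (-r ^ 2)) * ENNReal.ofReal (Real.exp (r * ξ t h i x)) :=
        fun x => by
          rw [← ENNReal.ofReal_mul (Real.exp_pos _).le, ← Real.exp_add]; ring_nf
      simp only [hmul]
      rw [lintegral_const_mul' _ _ ENNReal.ofReal_ne_top, ENNReal.ofReal_mul (Real.exp_pos _).le]
      refine mul_le_mul_right ((lintegral_exp_le (D i) ((hmi i).const_mul r) fun x => ?_).trans
        (ENNReal.ofReal_le_ofReal ?_)) _
      · rw [abs_mul, abs_of_nonneg hr0]
        exact mul_le_one₀ hr1 (abs_nonneg _) (hb t h i x)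
      · rw [integral_const_mul]
        gcongr
        refine (integral_mono_of_nonneg (g := fun _ => r ^ 2)
          (Filter.Eventually.of_forall fun x => sq_nonneg _) (integrable_const _)
          (Filter.Eventually.of_forall fun x => ?_)).trans_eq (by simp)
        simp only [mul_pow]
        have := (sq_le_one_iff_abs_le_one _).2 (hb t h i x)
        exact mul_le_of_le_one_right (sq_nonneg _) this
    -- Nonnegativity is needed to move `ENNReal.ofReal` across the sum over the arms.
    have hpos : ∀ i, 0 ≤ 1 + r * ∫ x, ξ t h i x ∂(D i) + r ^ 2 := fun i => by
      have : |∫ x, ξ t h i x ∂(D i)| ≤ 1 := by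
        have := norm_integral_le_of_norm_le_const (μ := D i) (f := ξ t h i) (C := 1)
          (Filter.Eventually.of_forall fun x => hb t h i x)
        simpa using this
      nlinarith [abs_le.1 this, sq_nonneg r]
    calc _ ≤ ∑ i, ENNReal.ofReal (π.dist t h i) *
          ENNReal.ofReal (Real.exp (-r ^ 2) * (1 + r * ∫ x, ξ t h i x ∂(D i) + r ^ 2)) := by
          gcongr with i; exact hi i
      _ = ENNReal.ofReal (∑ i, π.dist t h i *
          (Real.exp (-r ^ 2) * (1 + r * ∫ x, ξ t h i x ∂(D i) + r ^ 2))) := by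
          rw [ENNReal.ofReal_sum_of_nonneg fun i _ =>
            mul_nonneg ((π.mem_simplex t h).1 i) (mul_nonneg (Real.exp_pos _).le (hpos i))]
          refine Finset.sum_congr rfl fun i _ => ?_
          rw [ENNReal.ofReal_mul ((π.mem_simplex t h).1 i)]
      _ = ENNReal.ofReal (Real.exp (-r ^ 2) *
          (r * ∑ i, π.dist t h i * ∫ x, ξ t h i x ∂(D i) + (1 + r ^ 2))) := by
          congr 1
          have h1 : 1 + r ^ 2 = ∑ i, π.dist t h i * (1 + r ^ 2) := by
            rw [← Finset.sum_mul, (π.mem_simplex t h).2, one_mul]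
          rw [h1, Finset.mul_sum, ← Finset.sum_add_distrib, Finset.mul_sum]
          exact Finset.sum_congr rfl fun i _ => by ring
      _ ≤ ENNReal.ofReal 1 := by
          refine ENNReal.ofReal_le_ofReal ?_
          calc _ ≤ Real.exp (-r ^ 2) * Real.exp (r ^ 2) := by
                gcongr
                have := Real.add_one_le_exp (r ^ 2)
                nlinarith [hξ t h]
            _ = 1 := by rw [← Real.exp_add]; simp
      _ = 1 := ENNReal.ofReal_one
  have hmain := histLaw_le_pathSum_le D π
    (g := fun t h i x => r * ξ t h i x - r ^ 2)
    (fun t i => ((hm t i).const_mul r).sub_const _) hstep le_rfl (T := T) γ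
  refine (measure_mono fun h hh => ?_).trans hmain
  simp only [Set.mem_ofPred_eq] at hh ⊢
  have hsum : pathSum (fun t h i x => r * ξ t h i x - r ^ 2) (initialPart T le_rfl h) =
      r * pathSum ξ h - γ := by
    change pathSum (fun t h i x => r * ξ t h i x - r ^ 2) h = _
    simp only [pathSum, Finset.sum_sub_distrib, ← Finset.mul_sum, Finset.sum_const,
      Finset.card_univ, Fintype.card_fin, nsmul_eq_mul, hr2]
    field_simp
  rw [hsum]
  have hrs : r * Real.sqrt (γ * T) = γ := by
    rw [hr, ← Real.sqrt_mul (by positivity)]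
    rw [show γ / T * (γ * T) = γ ^ 2 by field_simp, Real.sqrt_sq hγ]
  nlinarith [mul_le_mul_of_nonneg_left hh.le hr0]

/-- The sum of component `j` of the vectors observed in the plays of arm `i`. -/
def armSum {t : ℕ} (h : History m d t) (j : Fin d) (i : Fin m) : ℝ :=
  ∑ s with (h s).1 = i, ((h s).2 j : ℝ)

lemma armSum_nonneg {t : ℕ} (h : History m d t) (j : Fin d) (i : Fin m) : 0 ≤ armSum h j i :=
  Finset.sum_nonneg fun _ _ => (coe_obs_mem _ j).1

lemma armSum_le_plays {t : ℕ} (h : History m d t) (j : Fin d) (i : Fin m) :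
    armSum h j i ≤ plays h i := by
  have := Finset.sum_le_card_nsmul (Finset.univ.filter (fun s => (h s).1 = i))
    (fun s => ((h s).2 j : ℝ)) 1 fun s _ => (coe_obs_mem _ j).2
  simpa [armSum, plays] using this

lemma plays_le {t : ℕ} (h : History m d t) (i : Fin m) : plays h i ≤ t := by
  simpa [plays] using Finset.card_filter_le (Finset.univ : Finset (Fin t)) (fun s => (h s).1 = i)

/-- Rounds in which another arm is played have increment `0`, so the number of plays may be random:
no stopping time or reindexing by plays is needed. -/
lemma histLaw_armSum_le (j : Fin d) (i : Fin m) {r : ℝ} (hr : |r| ≤ 1) {t T : ℕ} (ht : t ≤ T)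
    (a : ℝ) :
    histLaw D π T {h | a ≤ r * armSum (initialPart t ht h) j i -
      (r + r ^ 2) * (plays (initialPart t ht h) i * meanMatrix D j i)} ≤
        ENNReal.ofReal (Real.exp (-a)) := by
  set g : (t : ℕ) → History m d t → Fin m → Obs d → ℝ := fun _ _ i' x =>
    if i' = i then r * x j - (r + r ^ 2) * meanMatrix D j i else 0 with hg
  have hsum : ∀ {t : ℕ} (h : History m d t), pathSum g h =
      r * armSum h j i - (r + r ^ 2) * (plays h i * meanMatrix D j i) := by
    intro t h
    simp only [pathSum, hg, armSum, plays]
    rw [← Finset.sum_filter, Finset.sum_sub_distrib, ← Finset.mul_sum, Finset.sum_const,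
      nsmul_eq_mul]
    ring
  have := histLaw_le_pathSum_le D π (g := g) (fun t i' => ?_) (fun t h => ?_) ht a
  · simpa only [hsum] using this
  · by_cases hi : i' = i
    · simp only [hg, hi, if_true]
      exact ((((measurable_obs j).comp measurable_snd).const_mul r).sub_const _)
    · simp only [hg, hi, if_false]; exact measurable_const
  · rw [← sum_ofReal_dist π h]
    refine Finset.sum_le_sum fun i' _ => mul_le_of_le_one_right' ?_
    by_cases hi : i' = i
    · subst hi; simpa [hg] using lintegral_exp_obs_le_one D j i' hr
    · simp [hg, hi]

/-- The exponent `r` may depend on `μ`, the play count times the mean, but not on the observed sum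
`S`. The near-optimal choice is `√(γ/μ)`, for which `r² μ = γ`, truncated at `1`. -/
lemma exists_deviation_of_lt {γ μ : ℝ} (hγ : 0 < γ) (hμ : 0 ≤ μ) :
    ∃ r : ℝ, |r| ≤ 1 ∧ ∀ S, μ + 2 * Real.sqrt (γ * S) + 2 * γ < S →
      γ ≤ r * S - (r + r ^ 2) * μ := by
  by_cases hc : μ ≤ γ
  · refine ⟨1, by simp, fun S hS => ?_⟩
    have hS' : γ ≤ S := by nlinarith [Real.sqrt_nonneg (γ * S)]
    have : γ ≤ Real.sqrt (γ * S) := Real.le_sqrt_of_sq_le (by nlinarith)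
    linarith
  · push Not at hc
    have hμ0 : 0 < μ := hγ.trans hc
    refine ⟨Real.sqrt γ / Real.sqrt μ, ?_, fun S hS => ?_⟩
    · rw [abs_of_nonneg (by positivity)]
      exact (div_le_one (Real.sqrt_pos.2 hμ0)).2 (Real.sqrt_le_sqrt hc.le)
    · have hSμ : μ ≤ S := by nlinarith [Real.sqrt_nonneg (γ * S)]
      have h1 : Real.sqrt γ * Real.sqrt μ ≤ Real.sqrt (γ * S) := by
        rw [← Real.sqrt_mul hγ.le]; exact Real.sqrt_le_sqrt (by gcongr)
      have ha := Real.sq_sqrt hγ.le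
      have hb := Real.sq_sqrt hμ
      set a := Real.sqrt γ
      set b := Real.sqrt μ
      have ha0 : 0 < a := Real.sqrt_pos.2 hγ
      have hb0 : 0 < b := Real.sqrt_pos.2 hμ0
      have h2 : a / b * (S - μ) ≥ a / b * (2 * (a * b)) := by gcongr; linarith
      have h3 : a / b * (2 * (a * b)) = 2 * γ := by rw [← ha]; field_simp
      have h4 : (a / b) ^ 2 * μ = γ := by rw [← ha, ← hb]; field_simp
      linarith

/-- Lower-tail counterpart, with `r = -√(γ/μ)/2`: the linear term gains `γ/2` and the quadratic one
loses `γ/4`. -/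
lemma exists_deviation_of_gt {γ μ : ℝ} (hγ : 0 < γ) (hμ : 0 ≤ μ) :
    ∃ r : ℝ, |r| ≤ 1 ∧ ∀ S, 0 ≤ S → S + 2 * Real.sqrt (γ * S) + γ < μ →
      γ / 4 ≤ r * S - (r + r ^ 2) * μ := by
  by_cases hc : μ ≤ γ
  · refine ⟨0, by simp, fun S hS0 hS => ?_⟩
    have := Real.sqrt_nonneg (γ * S)
    linarith
  · push Not at hc
    have hμ0 : 0 < μ := hγ.trans hc
    have hab : Real.sqrt γ ≤ Real.sqrt μ := Real.sqrt_le_sqrt hc.le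
    refine ⟨-(Real.sqrt γ / Real.sqrt μ / 2), ?_, fun S hS0 hS => ?_⟩
    · rw [abs_neg, abs_of_nonneg (by positivity)]
      have := (div_le_one (Real.sqrt_pos.2 hμ0)).2 hab
      linarith
    · rw [Real.sqrt_mul hγ.le] at hS
      have ha := Real.sq_sqrt hγ.le
      have hb := Real.sq_sqrt hμ
      have hs := Real.sq_sqrt hS0
      have hs0 := Real.sqrt_nonneg S
      set a := Real.sqrt γ
      set b := Real.sqrt μ
      set s := Real.sqrt S
      have ha0 : 0 < a := Real.sqrt_pos.2 hγ
      have hb0 : 0 < b := Real.sqrt_pos.2 hμ0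
      -- The assumed deviation reads `(s + a)² < b²`; it yields `μ - S = (b - s)(b + s) ≥ a b`.
      have hsb : s + a < b := by
        refine lt_of_pow_lt_pow_left₀ 2 hb0.le ?_
        nlinarith
      have h2 : a * b ≤ μ - S := by
        rw [← hb, ← hs]
        nlinarith
      have h3 : a / b / 2 * (a * b) ≤ a / b / 2 * (μ - S) := by gcongr
      have h4 : a / b / 2 * (a * b) = γ / 2 := by rw [← ha]; field_simp
      have h5 : (a / b / 2) ^ 2 * μ = γ / 4 := by rw [← ha, ← hb]; field_simp; norm_num
      linarith

/-- Multiplied by `plays + 1`, the confidence radius becomes `√(γ S) + γ` with `S` the observed sum,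
which turns membership into the two deviation inequalities. -/
lemma mem_Icc_lcb_ucb {γ : ℝ} (hγ : 0 ≤ γ) {t : ℕ} (h : History m d t) (j : Fin d) (i : Fin m)
    {v : ℝ} (hv0 : 0 ≤ v) (hv1 : v ≤ 1)
    (h1 : armSum h j i ≤ (plays h i + 1) * v + 2 * Real.sqrt (γ * armSum h j i) + 2 * γ)
    (h2 : (plays h i + 1) * v ≤ armSum h j i + 2 * Real.sqrt (γ * armSum h j i) + 2 * γ) :
    v ∈ Set.Icc (lcb γ h j i) (ucb γ h j i) := by
  have hN : (0 : ℝ) < plays h i + 1 := by positivity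
  have hrad : rad γ (empMean h j i) (plays h i + 1) =
      (Real.sqrt (γ * armSum h j i) + γ) / (plays h i + 1) := by
    rw [rad, add_div]
    congr 1
    rw [show γ * empMean h j i / (plays h i + 1) =
      γ * armSum h j i / ((plays h i + 1) ^ 2 : ℝ) by
        change γ * (armSum h j i / (plays h i + 1)) / (plays h i + 1) = _
        field_simp]
    rw [Real.sqrt_div (mul_nonneg hγ (armSum_nonneg h j i)), Real.sqrt_sq hN.le]
  have hemp : empMean h j i = armSum h j i / (plays h i + 1) := rfl
  constructor
  · refine max_le hv0 ?_
    rw [hrad, hemp, mul_div_assoc', ← sub_div, div_le_iff₀ hN]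
    linarith
  · refine le_min hv1 ?_
    rw [hrad, hemp, mul_div_assoc', ← add_div, le_div_iff₀ hN]
    linarith

/-- The good exponent depends on the random number of plays, hence a union over its `T + 1` possible
values and over the two tails. -/
lemma histLaw_notMem_Icc_lcb_ucb_le (j : Fin d) (i : Fin m) {γ : ℝ} (hγ : 1 ≤ γ) {t T : ℕ}
    (ht : t ≤ T) :
    histLaw D π T {h | meanMatrix D j i ∉
      Set.Icc (lcb γ (initialPart t ht h) j i) (ucb γ (initialPart t ht h) j i)} ≤
        ENNReal.ofReal (2 * (T + 1) * Real.exp (-(γ / 4))) := by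
  have hγ0 : 0 < γ := by linarith
  set v := meanMatrix D j i with hv
  have hv0 : 0 ≤ v := meanMatrix_nonneg D j i
  have hv1 : v ≤ 1 := meanMatrix_le_one D j i
  choose r₁ hr₁ hdev₁ using fun k : ℕ =>
    exists_deviation_of_lt hγ0 (mul_nonneg (Nat.cast_nonneg k) hv0)
  choose r₂ hr₂ hdev₂ using fun k : ℕ =>
    exists_deviation_of_gt hγ0 (mul_nonneg (Nat.cast_nonneg k) hv0)
  let A : ℝ → Set (History m d T) := fun r =>
    {h | γ / 4 ≤ r * armSum (initialPart t ht h) j i -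
      (r + r ^ 2) * (plays (initialPart t ht h) i * v)}
  have hsub : {h | v ∉ Set.Icc (lcb γ (initialPart t ht h) j i)
      (ucb γ (initialPart t ht h) j i)} ⊆
        ⋃ k ∈ Finset.range (T + 1), (A (r₁ k) ∪ A (r₂ k)) := by
    intro h hh
    set h' := initialPart t ht h with hh'
    have hk : plays h' i ∈ Finset.range (T + 1) :=
      Finset.mem_range.2 (Nat.lt_succ_of_le ((plays_le h' i).trans ht))
    refine Set.mem_biUnion hk ?_
    by_contra hcon
    rw [Set.mem_union, not_or] at hcon
    simp only [A, Set.mem_ofPred_eq, not_le] at hcon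
    refine hh (mem_Icc_lcb_ucb hγ0.le h' j i hv0 hv1 ?_ ?_)
    · by_contra hlt
      push Not at hlt
      have := hdev₁ (plays h' i) (armSum h' j i) (by linarith)
      linarith [hcon.1]
    · by_contra hlt
      push Not at hlt
      -- The denominator is `plays + 1` but only `plays` samples exist; the surplus `v ≤ 1 ≤ γ` uses
      -- up one of the two `γ`s.
      have := hdev₂ (plays h' i) (armSum h' j i) (armSum_nonneg h' j i) (by linarith)
      linarith [hcon.2]
  have hA : ∀ r, |r| ≤ 1 → histLaw D π T (A r) ≤ ENNReal.ofReal (Real.exp (-(γ / 4))) :=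
    fun r hr => histLaw_armSum_le D π j i hr ht (γ / 4)
  calc _ ≤ histLaw D π T (⋃ k ∈ Finset.range (T + 1), (A (r₁ k) ∪ A (r₂ k))) :=
        measure_mono hsub
    _ ≤ ∑ k ∈ Finset.range (T + 1), histLaw D π T (A (r₁ k) ∪ A (r₂ k)) :=
        measure_biUnion_finset_le _ _
    _ ≤ ∑ k ∈ Finset.range (T + 1), (ENNReal.ofReal (Real.exp (-(γ / 4))) +
          ENNReal.ofReal (Real.exp (-(γ / 4)))) := by
        refine Finset.sum_le_sum fun k _ => (measure_union_le _ _).trans ?_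
        exact add_le_add (hA _ (hr₁ k)) (hA _ (hr₂ k))
    _ = _ := by
        rw [Finset.sum_const, Finset.card_range, ← ENNReal.ofReal_add (Real.exp_pos _).le
          (Real.exp_pos _).le, nsmul_eq_mul, ← ENNReal.ofReal_natCast,
          ← ENNReal.ofReal_mul (Nat.cast_nonneg _)]
        congr 1
        push_cast
        ring

end

/-! ### Confidence widths and their sum along a history. -/

section

variable {m d : ℕ}

lemma extend_initialPart {t : ℕ} (h : History m d (t + 1)) :
    extend (initialPart t t.le_succ h) (h (Fin.last t)).1 (h (Fin.last t)).2 = h := by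
  funext s
  induction s using Fin.lastCases with
  | last => simp
  | cast s => simp only [extend_castSucc]; rfl

lemma plays_extend {t : ℕ} (h : History m d t) (i : Fin m) (x : Obs d) (i' : Fin m) :
    plays (extend h i x) i' = plays h i' + if i = i' then 1 else 0 := by
  simp only [plays, Finset.card_filter, Fin.sum_univ_castSucc, extend_castSucc, extend_last]

lemma sum_plays {t : ℕ} (h : History m d t) : ∑ i, plays h i = t := by
  simp only [plays, Finset.card_filter]
  rw [Finset.sum_comm]
  simp

lemma measurable_plays {t : ℕ} (i : Fin m) :
    Measurable fun h : History m d t => (plays h i : ℝ) := by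
  simp only [plays, Finset.card_filter, Nat.cast_sum]
  refine Finset.measurable_sum _ fun s _ => ?_
  exact (measurable_of_finite fun i' : Fin m => ((if i' = i then 1 else 0 : ℕ) : ℝ)).comp
    (measurable_fst.comp (measurable_pi_apply s))

/-- An upper bound, common to all components, for the length of the confidence interval of an
arm. -/
def width (γ : ℝ) {t : ℕ} (h : History m d t) (i : Fin m) : ℝ :=
  min 1 (8 * Real.sqrt (γ / (plays h i + 1)))

lemma width_nonneg (γ : ℝ) {t : ℕ} (h : History m d t) (i : Fin m) : 0 ≤ width γ h i :=
  le_min zero_le_one (by positivity)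

lemma width_le_one (γ : ℝ) {t : ℕ} (h : History m d t) (i : Fin m) : width γ h i ≤ 1 :=
  min_le_left _ _

lemma measurable_width (γ : ℝ) {t : ℕ} (i : Fin m) :
    Measurable fun h : History m d t => width γ h i :=
  measurable_const.min
    ((measurable_const.div ((measurable_plays i).add_const 1)).sqrt.const_mul 8)

lemma empMean_le_one {t : ℕ} (h : History m d t) (j : Fin d) (i : Fin m) :
    empMean h j i ≤ 1 :=
  div_le_one_of_le₀ ((armSum_le_plays h j i).trans (by linarith)) (by positivity)

/-- The length is at most four radii. If `γ/N ≤ 1` the square root dominates `γ/N` and four radii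
are at most `8 √(γ/N)`; otherwise the trivial bound `1` is smaller. -/
lemma ucb_sub_lcb_le_width {γ : ℝ} (hγ : 0 ≤ γ) {t : ℕ} (h : History m d t) (j : Fin d)
    (i : Fin m) : ucb γ h j i - lcb γ h j i ≤ width γ h i := by
  have h1 : ucb γ h j i ≤ 1 := min_le_left _ _
  have h2 : 0 ≤ lcb γ h j i := le_max_left _ _
  have h3 : ucb γ h j i ≤ empMean h j i + 2 * rad γ (empMean h j i) (plays h i + 1) :=
    min_le_right _ _
  have h4 : empMean h j i - 2 * rad γ (empMean h j i) (plays h i + 1) ≤ lcb γ h j i :=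
    le_max_right _ _
  have hN : (0 : ℝ) < plays h i + 1 := by positivity
  refine le_min (by linarith) ?_
  set N : ℝ := plays h i + 1
  have hs0 : 0 ≤ γ / N := by positivity
  by_cases hc : γ / N ≤ 1
  · have h5 : Real.sqrt (γ * empMean h j i / N) ≤ Real.sqrt (γ / N) := by
      refine Real.sqrt_le_sqrt ?_
      gcongr
      exact mul_le_of_le_one_right hγ (empMean_le_one h j i)
    have h6 : γ / N ≤ Real.sqrt (γ / N) := Real.le_sqrt_of_sq_le (by nlinarith)
    unfold rad at h3 h4
    linarith
  · have : 1 ≤ Real.sqrt (γ / N) := Real.one_le_sqrt.2 (le_of_not_ge hc)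
    linarith

lemma abs_sub_le_width {γ : ℝ} (hγ : 0 ≤ γ) {t : ℕ} {h : History m d t}
    {U V : Matrix (Fin d) (Fin m) ℝ} (hU : U ∈ confCube γ h) (hV : V ∈ confCube γ h)
    (j : Fin d) (i : Fin m) : |U j i - V j i| ≤ width γ h i := by
  have h1 := ucb_sub_lcb_le_width hγ h j i
  have h2 := hU j i
  have h3 := hV j i
  rw [abs_le]
  constructor <;> linarith [h2.1, h2.2, h3.1, h3.2]

lemma mulVec_mem_cube {U : Matrix (Fin d) (Fin m) ℝ} (h0 : ∀ j i, 0 ≤ U j i)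
    (h1 : ∀ j i, U j i ≤ 1) {p : Fin m → ℝ} (hp : p ∈ stdSimplex ℝ (Fin m)) :
    U.mulVec p ∈ cube d := by
  refine ⟨fun j => ?_, fun j => ?_⟩
  · change 0 ≤ ∑ i, U j i * p i
    exact Finset.sum_nonneg fun i _ => mul_nonneg (h0 j i) (hp.1 i)
  · calc ∑ i, U j i * p i ≤ ∑ i, p i :=
          Finset.sum_le_sum fun i _ => mul_le_of_le_one_left (hp.1 i) (h1 j i)
      _ = 1 := hp.2

lemma mulVec_mem_cube_of_mem_confCube {γ : ℝ} {t : ℕ} {h : History m d t}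
    {U : Matrix (Fin d) (Fin m) ℝ} (hU : U ∈ confCube γ h) {p : Fin m → ℝ}
    (hp : p ∈ stdSimplex ℝ (Fin m)) : U.mulVec p ∈ cube d :=
  mulVec_mem_cube (fun j i => (le_max_left _ _).trans (hU j i).1)
    (fun j i => (hU j i).2.trans (min_le_left _ _)) hp

lemma meanMatrix_mulVec_mem_cube (D : Fin m → Measure (Obs d)) [∀ i, IsProbabilityMeasure (D i)]
    {p : Fin m → ℝ} (hp : p ∈ stdSimplex ℝ (Fin m)) : (meanMatrix D).mulVec p ∈ cube d :=
  mulVec_mem_cube (meanMatrix_nonneg D) (meanMatrix_le_one D) hp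

/-- The right side is a potential: playing an arm for the `(k+1)`-st time raises it by `16 √γ
(√(k+1) - √k) ≥ 8 √γ / √(k+1)`, which covers the width. -/
lemma pathSum_width_le_sum_sqrt {γ : ℝ} {t : ℕ} (h : History m d t) :
    pathSum (fun _ h i _ => width γ h i) h ≤
      16 * Real.sqrt γ * ∑ i, Real.sqrt (plays h i) := by
  induction t with
  | zero => simpa [pathSum] using by positivity
  | succ t ih =>
    rw [← extend_initialPart h, pathSum_extend]
    set h' := initialPart t t.le_succ h
    set i := (h (Fin.last t)).1
    set x := (h (Fin.last t)).2
    have hsum : ∑ i', Real.sqrt (plays (extend h' i x) i') =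
        ∑ i', Real.sqrt (plays h' i') +
          (Real.sqrt (plays h' i + 1) - Real.sqrt (plays h' i)) := by
      have : ∀ i', Real.sqrt (plays (extend h' i x) i') = Real.sqrt (plays h' i') +
          if i = i' then Real.sqrt (plays h' i + 1) - Real.sqrt (plays h' i) else 0 := by
        intro i'
        rw [plays_extend]
        by_cases hi : i = i'
        · subst hi; simp
        · simp [hi]
      simp only [this, Finset.sum_add_distrib]
      simp
    rw [hsum, mul_add]
    refine add_le_add (ih h') ((min_le_right _ _).trans ?_)
    have hk : (0 : ℝ) ≤ plays h' i := Nat.cast_nonneg _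
    rw [Real.sqrt_div' _ (by positivity), mul_div_assoc', div_le_iff₀ (by positivity)]
    have ha := Real.sq_sqrt hk
    have hb := Real.sq_sqrt (by positivity : (0 : ℝ) ≤ plays h' i + 1)
    have hg := Real.sqrt_nonneg γ
    set a := Real.sqrt (plays h' i)
    set b := Real.sqrt (plays h' i + 1)
    have : 1 ≤ 2 * ((b - a) * b) := by nlinarith [sq_nonneg (b - a)]
    nlinarith

lemma pathSum_width_le {γ : ℝ} (hγ : 0 ≤ γ) {T : ℕ} (h : History m d T) :
    pathSum (fun _ h i _ => width γ h i) h ≤ 16 * Real.sqrt (γ * m * T) := by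
  refine (pathSum_width_le_sum_sqrt h).trans ?_
  rw [mul_assoc γ, Real.sqrt_mul hγ, mul_assoc]
  gcongr
  refine Real.le_sqrt_of_sq_le ?_
  -- Cauchy–Schwarz, with play counts that add up to `T`.
  have h1 := sq_sum_le_card_mul_sum_sq (s := Finset.univ) (f := fun i => Real.sqrt (plays h i))
  have h2 : ∑ i, Real.sqrt (plays h i) ^ 2 = T := by
    simp only [Real.sq_sqrt (Nat.cast_nonneg _)]
    exact_mod_cast sum_plays h
  rwa [h2, Finset.card_univ, Fintype.card_fin] at h1

/-- This deterministic estimate serves both regrets: `U` may be any choice of matrices from the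
confidence cubes. -/
lemma abs_sum_mulVec_sub_obs_le (π : Policy m d) (V : Matrix (Fin d) (Fin m) ℝ) {γ : ℝ}
    (hγ : 0 ≤ γ) (hm : 1 ≤ m) {T : ℕ} (h : History m d T)
    (hV : ∀ s : Fin T, V ∈ confCube γ (initialPart s s.isLt.le h))
    (hw : pathSum (fun t h i _ => ∑ i', π.dist t h i' * width γ h i' - width γ h i) h ≤
      2 * Real.sqrt (γ * T)) (j : Fin d)
    (hobs : |pathSum (fun t h _ x => (x j : ℝ) - V.mulVec (π.dist t h) j) h| ≤
      2 * Real.sqrt (γ * T))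
    {U : Fin T → Matrix (Fin d) (Fin m) ℝ}
    (hU : ∀ s : Fin T, U s ∈ confCube γ (initialPart s s.isLt.le h)) :
    |∑ s : Fin T, ((U s).mulVec (π.dist s (initialPart s s.isLt.le h)) j - ((h s).2 j : ℝ))| ≤
      20 * Real.sqrt (γ * m * T) := by
  have hsqrt : Real.sqrt (γ * T) ≤ Real.sqrt (γ * m * T) := by
    refine Real.sqrt_le_sqrt ?_
    have : (1 : ℝ) ≤ m := by exact_mod_cast hm
    gcongr
    exact le_mul_of_one_le_right hγ this
  have hwidth := pathSum_width_le hγ h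
  simp only [pathSum] at hw hobs hwidth
  rw [Finset.sum_sub_distrib] at hw
  have hdev : |∑ s : Fin T, ((U s).mulVec (π.dist s (initialPart s s.isLt.le h)) j -
      V.mulVec (π.dist s (initialPart s s.isLt.le h)) j)| ≤
      ∑ s : Fin T, ∑ i', π.dist s (initialPart s s.isLt.le h) i' *
        width γ (initialPart s s.isLt.le h) i' := by
    refine (Finset.abs_sum_le_sum_abs _ _).trans (Finset.sum_le_sum fun s _ => ?_)
    simp only [Matrix.mulVec, dotProduct]
    rw [← Finset.sum_sub_distrib]
    refine (Finset.abs_sum_le_sum_abs _ _).trans (Finset.sum_le_sum fun i _ => ?_)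
    have hp := (π.mem_simplex s (initialPart s s.isLt.le h)).1 i
    rw [← sub_mul, abs_mul, abs_of_nonneg hp, mul_comm]
    exact mul_le_mul_of_nonneg_left (abs_sub_le_width hγ (hU s) (hV s) j i) hp
  have hsplit : ∑ s : Fin T, ((U s).mulVec (π.dist s (initialPart s s.isLt.le h)) j -
      ((h s).2 j : ℝ)) = ∑ s : Fin T, ((U s).mulVec (π.dist s (initialPart s s.isLt.le h)) j -
      V.mulVec (π.dist s (initialPart s s.isLt.le h)) j) -
      ∑ s : Fin T, (((h s).2 j : ℝ) - V.mulVec (π.dist s (initialPart s s.isLt.le h)) j) := by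
    rw [← Finset.sum_sub_distrib]
    exact Finset.sum_congr rfl fun s _ => by ring
  rw [hsplit]
  refine (abs_sub _ _).trans ?_
  linarith

end

/-! ### Norms, distance to `S`, and the objective on the cube. -/

section

variable {m d : ℕ}

lemma lqNorm_nonneg (q : ℝ≥0∞) [Fact (1 ≤ q)] (x : Fin d → ℝ) : 0 ≤ lqNorm q x :=
  norm_nonneg (WithLp.toLp q x)

lemma lqNorm_le_of_abs_le (q : ℝ≥0∞) [hq : Fact (1 ≤ q)] {x : Fin d → ℝ} {a : ℝ} (ha : 0 ≤ a)
    (hx : ∀ j, |x j| ≤ a) : lqNorm q x ≤ a * lqNorm q (1 : Fin d → ℝ) := by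
  have hsmul : a * lqNorm q (1 : Fin d → ℝ) = ‖WithLp.toLp q (fun _ : Fin d => a)‖ := by
    have : WithLp.toLp q (fun _ : Fin d => a) = a • WithLp.toLp q (1 : Fin d → ℝ) := by
      ext j; simp
    rw [this, norm_smul, Real.norm_of_nonneg ha, lqNorm]
  rw [hsmul, lqNorm]
  by_cases h : q = ∞
  · subst h
    rw [PiLp.norm_eq_ciSup, PiLp.norm_eq_ciSup]
    refine ciSup_mono (Set.finite_range _).bddAbove fun j => ?_
    simpa [abs_of_nonneg ha] using hx j
  · have hp : 0 < q.toReal := ENNReal.toReal_pos (zero_lt_one.trans_le hq.out).ne' h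
    rw [PiLp.norm_eq_sum hp, PiLp.norm_eq_sum hp]
    gcongr with j
    simpa [abs_of_nonneg ha] using hx j

lemma mem_closure_toLp_image (q : ℝ≥0∞) {x : Fin d → ℝ} {S : Set (Fin d → ℝ)} :
    WithLp.toLp q x ∈ closure (WithLp.toLp q '' S) ↔ x ∈ closure S := by
  have h := (PiLp.homeomorph q (fun _ : Fin d => ℝ)).symm.image_closure S
  have himg : WithLp.toLp q '' closure S = closure (WithLp.toLp q '' S) := h
  rw [← himg]
  exact (WithLp.toLp_injective q).mem_set_image

/-- Nonemptiness matters, because `Metric.infDist` to the empty set is `0`. As `S` need not be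
closed, the constraint only sees its closure. -/
lemma lqDist_nonpos_iff (q : ℝ≥0∞) [Fact (1 ≤ q)] {S : Set (Fin d → ℝ)} (hS : S.Nonempty)
    {x : Fin d → ℝ} : lqDist q x S ≤ 0 ↔ x ∈ closure S := by
  rw [← mem_closure_toLp_image q, Metric.mem_closure_iff_infDist_zero (hS.image _), lqDist]
  exact ⟨fun h => le_antisymm h Metric.infDist_nonneg, le_of_eq⟩

lemma lqDist_le (q : ℝ≥0∞) [Fact (1 ≤ q)] {S : Set (Fin d → ℝ)} {x y : Fin d → ℝ}
    (hy : y ∈ closure S) : lqDist q x S ≤ lqNorm q (x - y) := by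
  rw [lqDist, ← Metric.infDist_closure]
  refine (Metric.infDist_le_dist_of_mem ((mem_closure_toLp_image q).2 hy)).trans_eq ?_
  rw [dist_eq_norm, lqNorm, WithLp.toLp_sub]

lemma avgObs_mem_cube {T : ℕ} (hT : 0 < T) (h : History m d T) : avgObs h ∈ cube d := by
  have hT' : (0 : ℝ) < T := by exact_mod_cast hT
  refine ⟨fun j => ?_, fun j => ?_⟩
  · exact div_nonneg (Finset.sum_nonneg fun s _ => (coe_obs_mem _ j).1) hT'.le
  · refine (div_le_one hT').2 ((Finset.sum_le_sum fun s _ => (coe_obs_mem (h s).2 j).2).trans ?_)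
    simp

lemma measurable_avgObs {T : ℕ} : Measurable fun h : History m d T => avgObs h := by
  refine measurable_pi_lambda _ fun j => ?_
  refine (Finset.measurable_sum _ fun s _ => ?_).div_const _
  exact (measurable_obs j).comp (measurable_snd.comp (measurable_pi_apply s))

/-- Adding the Lipschitz inequalities for `(0, 1)` and `(1, 0)` gives `0 ≤ 2 L ‖1‖`, and `‖1‖ > 0`
because `d > 0`. -/
lemma lipschitz_const_nonneg {f : (Fin d → ℝ) → ℝ} {q : ℝ≥0∞} [Fact (1 ≤ q)] {L : ℝ}
    (hL : ∀ x ∈ cube d, ∀ y ∈ cube d, f x - f y ≤ L * lqNorm q (x - y)) 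
    (hd : 0 < d) : 0 ≤ L := by
  have h0 : (0 : Fin d → ℝ) ∈ cube d := ⟨le_rfl, zero_le_one⟩
  have h1 : (1 : Fin d → ℝ) ∈ cube d := ⟨zero_le_one, le_rfl⟩
  have ha := hL 1 h1 0 h0
  have hb := hL 0 h0 1 h1
  have hneg : lqNorm q (0 - 1 : Fin d → ℝ) = lqNorm q (1 - 0 : Fin d → ℝ) := by
    rw [lqNorm, lqNorm, ← norm_neg, ← WithLp.toLp_neg, neg_sub]
  have hpos : 0 < lqNorm q (1 - 0 : Fin d → ℝ) := by
    refine norm_pos_iff.2 fun h => ?_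
    have := congrArg (fun v : PiLp q (fun _ : Fin d => ℝ) => v ⟨0, hd⟩) h
    simp at this
  rw [hneg] at hb
  by_contra hcon
  push Not at hcon
  nlinarith

lemma sub_le_of_abs_le {f : (Fin d → ℝ) → ℝ} {q : ℝ≥0∞} [Fact (1 ≤ q)] {L : ℝ}
    (hL : ∀ x ∈ cube d, ∀ y ∈ cube d, f x - f y ≤ L * lqNorm q (x - y)) 
    (hL0 : 0 ≤ L) {x y : Fin d → ℝ} (hx : x ∈ cube d) (hy : y ∈ cube d)
    {a : ℝ} (ha : 0 ≤ a) (hxy : ∀ j, |x j - y j| ≤ a) :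
    f x - f y ≤ L * lqNorm q (1 : Fin d → ℝ) * a := by
  refine (hL x hx y hy).trans ?_
  rw [mul_assoc, mul_comm (lqNorm q 1)]
  exact mul_le_mul_of_nonneg_left (lqNorm_le_of_abs_le q ha hxy) hL0

lemma continuousOn_cube {f : (Fin d → ℝ) → ℝ} {q : ℝ≥0∞} [Fact (1 ≤ q)] {L : ℝ}
    (hL : ∀ x ∈ cube d, ∀ y ∈ cube d, f x - f y ≤ L * lqNorm q (x - y)) 
    (hL0 : 0 ≤ L) : ContinuousOn f (cube d) := by
  have hK : 0 ≤ L * lqNorm q (1 : Fin d → ℝ) := mul_nonneg hL0 (lqNorm_nonneg q _)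
  have : LipschitzOnWith (L * lqNorm q (1 : Fin d → ℝ)).toNNReal f (cube d) := by
    refine LipschitzOnWith.of_dist_le_mul fun x hx y hy => ?_
    rw [Real.coe_toNNReal _ hK, Real.dist_eq, abs_sub_le_iff]
    have h1 : ∀ j, |x j - y j| ≤ dist x y := fun j => dist_le_pi_dist x y j
    have h2 : ∀ j, |y j - x j| ≤ dist x y := fun j => by rw [abs_sub_comm]; exact h1 j
    exact ⟨sub_le_of_abs_le hL hL0 hx hy dist_nonneg h1,
      sub_le_of_abs_le hL hL0 hy hx dist_nonneg h2⟩
  exact this.continuousOn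

/-! ### The dynamic benchmark is at most the best fixed distribution. -/

section Benchmark

variable (D : Fin m → Measure (Obs d)) [∀ i, IsProbabilityMeasure (D i)] (π : Policy m d)

/-- The probability that arm `i` is played in round `t`. -/
def playProb (t : ℕ) (i : Fin m) : ℝ := ∫ h, π.dist t h i ∂(histLaw D π t)

lemma integrable_dist (t : ℕ) (i : Fin m) :
    Integrable (fun h => π.dist t h i) (histLaw D π t) := by
  refine Integrable.of_bound
    ((measurable_pi_apply i).comp (π.measurable_dist t)).aestronglyMeasurable 1
    (Filter.Eventually.of_forall fun h => ?_)
  have h1 := π.mem_simplex t h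
  rw [Real.norm_eq_abs, abs_of_nonneg (h1.1 i), ← h1.2]
  exact Finset.single_le_sum (fun i _ => h1.1 i) (Finset.mem_univ i)

lemma playProb_mem_stdSimplex (t : ℕ) : playProb D π t ∈ stdSimplex ℝ (Fin m) := by
  refine ⟨fun i => integral_nonneg fun h => (π.mem_simplex t h).1 i, ?_⟩
  simp only [playProb]
  rw [← integral_finsetSum _ fun i _ => integrable_dist D π t i]
  simp only [(π.mem_simplex t _).2]
  simp

lemma lintegral_pathSum_obs (j : Fin d) (t : ℕ) :
    ∫⁻ h, ENNReal.ofReal (pathSum (fun _ _ _ x => (x j : ℝ)) h) ∂(histLaw D π t) =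
      ∑ s ∈ Finset.range t, ENNReal.ofReal ((meanMatrix D).mulVec (playProb D π s) j) := by
  have hm : ∀ t, Measurable fun h : History m d t => pathSum (fun _ _ _ x => (x j : ℝ)) h :=
    measurable_pathSum fun _ _ => (measurable_obs j).comp measurable_snd
  induction t with
  | zero => simp [histLaw, pathSum]
  | succ t ih =>
    rw [lintegral_histLaw_succ D π (hm _).ennreal_ofReal, Finset.sum_range_succ, ← ih]
    have hobs : ∀ i, ∫⁻ x : Obs d, ENNReal.ofReal (x j) ∂(D i) =
        ENNReal.ofReal (meanMatrix D j i) := fun i =>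
      (ofReal_integral_eq_lintegral_ofReal (integrable_obs (D i) j)
        (Filter.Eventually.of_forall fun x => (coe_obs_mem x j).1)).symm
    have hstep : ∀ h : History m d t, ∑ i, ENNReal.ofReal (π.dist t h i) *
        ∫⁻ x, ENNReal.ofReal (pathSum (fun _ _ _ x => (x j : ℝ)) (extend h i x)) ∂(D i) =
        ENNReal.ofReal (pathSum (fun _ _ _ x => (x j : ℝ)) h) +
          ENNReal.ofReal ((meanMatrix D).mulVec (π.dist t h) j) := by
      intro h
      have h0 : 0 ≤ pathSum (fun _ _ _ x => (x j : ℝ)) h :=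
        Finset.sum_nonneg fun s _ => (coe_obs_mem _ j).1
      have hi : ∀ i, ∫⁻ x, ENNReal.ofReal
          (pathSum (fun _ _ _ x => (x j : ℝ)) (extend h i x)) ∂(D i) =
          ENNReal.ofReal (pathSum (fun _ _ _ x => (x j : ℝ)) h) +
            ENNReal.ofReal (meanMatrix D j i) := by
        intro i
        rw [← hobs i]
        simp only [pathSum_extend, ENNReal.ofReal_add h0 (coe_obs_mem _ j).1]
        rw [lintegral_add_left measurable_const, lintegral_const, measure_univ, mul_one]
      simp only [hi, mul_add, Finset.sum_add_distrib, ← Finset.sum_mul, sum_ofReal_dist, one_mul]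
      congr 1
      rw [Matrix.mulVec, dotProduct, ENNReal.ofReal_sum_of_nonneg fun i _ =>
        mul_nonneg (meanMatrix_nonneg D j i) ((π.mem_simplex t h).1 i)]
      exact Finset.sum_congr rfl fun i _ => by
        rw [ENNReal.ofReal_mul (meanMatrix_nonneg D j i), mul_comm]
    simp only [hstep]
    rw [lintegral_add_left (hm t).ennreal_ofReal]
    congr 1
    have hint : ∀ i ∈ Finset.univ,
        Integrable (fun h => meanMatrix D j i * π.dist t h i) (histLaw D π t) :=
      fun i _ => (integrable_dist D π t i).const_mul _
    have hmean : ∫ h, (meanMatrix D).mulVec (π.dist t h) j ∂(histLaw D π t) =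
        (meanMatrix D).mulVec (playProb D π t) j := by
      simp only [Matrix.mulVec, dotProduct]
      rw [integral_finsetSum _ hint]
      exact Finset.sum_congr rfl fun i _ => integral_const_mul _ _
    rw [← hmean, ofReal_integral_eq_lintegral_ofReal]
    · simpa only [Matrix.mulVec, dotProduct] using integrable_finsetSum _ hint
    · exact Filter.Eventually.of_forall fun h =>
        (meanMatrix_mulVec_mem_cube D (π.mem_simplex t h)).1 j

lemma integrable_avgObs {T : ℕ} (hT : 0 < T) :
    Integrable (fun h : History m d T => avgObs h) (histLaw D π T) := by
  refine Integrable.of_bound measurable_avgObs.aestronglyMeasurable 1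
    (Filter.Eventually.of_forall fun h => ?_)
  have := avgObs_mem_cube hT h
  refine (pi_norm_le_iff_of_nonneg zero_le_one).2 fun j => ?_
  rw [Real.norm_eq_abs, abs_of_nonneg (this.1 j)]
  exact this.2 j

/-- The expected average observation of a policy is that of a fixed distribution over arms. -/
lemma exists_integral_avgObs_eq {T : ℕ} (hT : 0 < T) :
    ∃ p ∈ stdSimplex ℝ (Fin m), ∫ h, avgObs h ∂(histLaw D π T) = (meanMatrix D).mulVec p := by
  have hT' : (0 : ℝ) < T := by exact_mod_cast hT
  -- The witness is the expected fraction of rounds in which each arm is played.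
  refine ⟨∑ s ∈ Finset.range T, (1 / T : ℝ) • playProb D π s,
    (convex_stdSimplex ℝ (Fin m)).sum_mem (fun _ _ => by positivity) (by simp; field_simp)
      fun s _ => playProb_mem_stdSimplex D π s, ?_⟩
  funext j
  rw [eval_integral fun j => (integrable_pi_iff.1 (integrable_avgObs D π hT)) j]
  have hnn : ∀ s, 0 ≤ (meanMatrix D).mulVec (playProb D π s) j := fun s =>
    (meanMatrix_mulVec_mem_cube D (playProb_mem_stdSimplex D π s)).1 j
  have hsum : ∫ h : History m d T, pathSum (fun _ _ _ x => (x j : ℝ)) h ∂(histLaw D π T) =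
      ∑ s ∈ Finset.range T, (meanMatrix D).mulVec (playProb D π s) j := by
    rw [integral_eq_lintegral_of_nonneg_ae, lintegral_pathSum_obs,
      ← ENNReal.ofReal_sum_of_nonneg fun s _ => hnn s,
      ENNReal.toReal_ofReal (Finset.sum_nonneg fun s _ => hnn s)]
    · exact Filter.Eventually.of_forall fun h =>
        Finset.sum_nonneg fun s _ => (coe_obs_mem _ j).1
    · exact (measurable_pathSum (fun _ _ => (measurable_obs j).comp measurable_snd)
        T).aestronglyMeasurable
  have havg : ∀ h : History m d T, avgObs h j =
      pathSum (fun _ _ _ x => (x j : ℝ)) h / T := fun _ => rfl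
  simp only [havg]
  rw [integral_div, hsum, Matrix.mulVec_sum, Finset.sum_apply, Finset.sum_div]
  refine Finset.sum_congr rfl fun s _ => ?_
  rw [Matrix.mulVec_smul, Pi.smul_apply, smul_eq_mul]
  ring

/-- Jensen's inequality moves the expectation inside `f`, and the mean of an `S`-valued average
stays in the closed convex set `closure S`. -/
lemma optValue_le {f : (Fin d → ℝ) → ℝ} {S : Set (Fin d → ℝ)} (hf : ConcaveOn ℝ (cube d) f)
    (hf01 : ∀ x ∈ cube d, f x ∈ Set.Icc (0 : ℝ) 1) (hfc : ContinuousOn f (cube d))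
    (hS : Convex ℝ S) {T : ℕ} (hT : 0 < T) {b : ℝ} (hb0 : 0 ≤ b)
    (hb : ∀ p ∈ stdSimplex ℝ (Fin m), (meanMatrix D).mulVec p ∈ closure S →
      f ((meanMatrix D).mulVec p) ≤ b) :
    optValue D f S T ≤ b := by
  -- `0 ≤ b` covers the case without admissible policies, where the supremum is `0`.
  refine Real.sSup_le ?_ hb0
  rintro r ⟨π, hπ, rfl⟩
  obtain ⟨p, hp, hpe⟩ := exists_integral_avgObs_eq D π hT
  have hmem : ∫ h, avgObs h ∂(histLaw D π T) ∈ closure S :=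
    hS.closure.integral_mem isClosed_closure (hπ.mono fun h hh => subset_closure hh)
      (integrable_avgObs D π hT)
  have hclosed : IsClosed (cube d) := isClosed_Icc
  -- Continuity of `f` is known only on the cube, so measurability is obtained through the subtype.
  have hmeas : Measurable fun h : History m d T => f (avgObs h) := by
    have h1 : Measurable fun x : cube d => f x :=
      (continuousOn_iff_continuous_domRestrict.1 hfc).measurable
    exact h1.comp (measurable_avgObs.subtype_mk (h := fun h => avgObs_mem_cube hT h))
  have hint : Integrable (f ∘ fun h : History m d T => avgObs h) (histLaw D π T) := by
    refine Integrable.of_bound hmeas.aestronglyMeasurable 1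
      (Filter.Eventually.of_forall fun h => ?_)
    have := hf01 _ (avgObs_mem_cube hT h)
    rw [Function.comp_apply, Real.norm_eq_abs, abs_of_nonneg this.1]
    exact this.2
  refine (hf.le_map_integral hfc hclosed
    (Filter.Eventually.of_forall fun h => avgObs_mem_cube hT h)
    (integrable_avgObs D π hT) hint).trans ?_
  rw [hpe] at hmem ⊢
  exact hb p hp hmem

end Benchmark

end

/-! ### Typical histories: their probability and the regrets along them. -/

section

variable {m d : ℕ}

/-- The histories along which the confidence intervals contain the means and the martingales of the
widths and of the observations stay small. -/
def IsTypical (D : Fin m → Measure (Obs d)) (π : Policy m d) (γ : ℝ) {T : ℕ}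
    (h : History m d T) : Prop :=
  (∀ s : Fin T, meanMatrix D ∈ confCube γ (initialPart s s.isLt.le h)) ∧
  pathSum (fun t h i _ => ∑ i', π.dist t h i' * width γ h i' - width γ h i) h ≤
    2 * Real.sqrt (γ * T) ∧
  ∀ j, |pathSum (fun t h _ x => (x j : ℝ) - (meanMatrix D).mulVec (π.dist t h) j) h| ≤
    2 * Real.sqrt (γ * T)

section Probability

variable (D : Fin m → Measure (Obs d)) [∀ i, IsProbabilityMeasure (D i)] (π : Policy m d)

lemma sum_dist_mul_mem_Icc {t : ℕ} (h : History m d t) {a : Fin m → ℝ}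
    (ha : ∀ i, a i ∈ Set.Icc (0 : ℝ) 1) : ∑ i, π.dist t h i * a i ∈ Set.Icc (0 : ℝ) 1 := by
  have hp := π.mem_simplex t h
  refine ⟨Finset.sum_nonneg fun i _ => mul_nonneg (hp.1 i) (ha i).1, ?_⟩
  rw [← hp.2]
  exact Finset.sum_le_sum fun i _ => mul_le_of_le_one_right (hp.1 i) (ha i).2

lemma measurable_dist_apply (t : ℕ) (i : Fin m) : Measurable fun h => π.dist t h i :=
  (measurable_pi_apply i).comp (π.measurable_dist t)

lemma histLaw_lt_pathSum_width_le {γ : ℝ} (hγ : 0 ≤ γ) {T : ℕ} (hγT : γ ≤ T) (hT : 0 < T) :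
    histLaw D π T {h | 2 * Real.sqrt (γ * T) <
      pathSum (fun t h i _ => ∑ i', π.dist t h i' * width γ h i' - width γ h i) h} ≤
        ENNReal.ofReal (Real.exp (-γ)) := by
  refine histLaw_azuma D π (fun t i => ?_) (fun t h i x => ?_) (fun t h => ?_) hγ hγT hT
  · refine Measurable.comp (g := fun h => ∑ i', π.dist t h i' * width γ h i' - width γ h i)
      ?_ measurable_fst
    exact (Finset.measurable_sum _ fun i' _ =>
      (measurable_dist_apply π t i').mul (measurable_width γ i')).sub (measurable_width γ i)
  · have h1 := sum_dist_mul_mem_Icc π h fun i => ⟨width_nonneg γ h i, width_le_one γ h i⟩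
    rw [abs_le]
    constructor <;> linarith [h1.1, h1.2, width_nonneg γ h i, width_le_one γ h i]
  · simp only [integral_const, probReal_univ, one_smul, mul_sub, Finset.sum_sub_distrib,
      ← Finset.sum_mul, (π.mem_simplex t h).2, one_mul, sub_self, le_refl]

lemma histLaw_lt_abs_pathSum_obs_le (j : Fin d) {γ : ℝ} (hγ : 0 ≤ γ) {T : ℕ} (hγT : γ ≤ T)
    (hT : 0 < T) :
    histLaw D π T {h | 2 * Real.sqrt (γ * T) <
      |pathSum (fun t h _ x => (x j : ℝ) - (meanMatrix D).mulVec (π.dist t h) j) h|} ≤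
        ENNReal.ofReal (2 * Real.exp (-γ)) := by
  set ξ : (t : ℕ) → History m d t → Fin m → Obs d → ℝ := fun t h _ x =>
    (x j : ℝ) - (meanMatrix D).mulVec (π.dist t h) j with hξ
  have hmeas : ∀ t i, Measurable (fun z : History m d t × Obs d => ξ t z.1 i z.2) := by
    intro t i
    refine ((measurable_obs j).comp measurable_snd).sub (Measurable.comp
      (g := fun h => (meanMatrix D).mulVec (π.dist t h) j) ?_ measurable_fst)
    simp only [Matrix.mulVec, dotProduct]
    exact Finset.measurable_sum _ fun i' _ => (measurable_dist_apply π t i').const_mul _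
  have hb : ∀ t h i x, |ξ t h i x| ≤ 1 := by
    intro t h i x
    have h1 : 0 ≤ (meanMatrix D).mulVec (π.dist t h) j :=
      (meanMatrix_mulVec_mem_cube D (π.mem_simplex t h)).1 j
    have h3 : (meanMatrix D).mulVec (π.dist t h) j ≤ 1 :=
      (meanMatrix_mulVec_mem_cube D (π.mem_simplex t h)).2 j
    have h2 := coe_obs_mem x j
    simp only [hξ]
    rw [abs_le]
    constructor <;> linarith [h2.1, h2.2]
  have hmean : ∀ t h, ∑ i, π.dist t h i * ∫ x, ξ t h i x ∂(D i) = 0 := by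
    intro t h
    have : ∀ i, ∫ x, ξ t h i x ∂(D i) =
        meanMatrix D j i - (meanMatrix D).mulVec (π.dist t h) j := by
      intro i
      simp only [hξ]
      rw [integral_sub (integrable_obs (D i) j) (integrable_const _), integral_const,
        probReal_univ, one_smul]
      rfl
    simp only [this, mul_sub, Finset.sum_sub_distrib, ← Finset.sum_mul, (π.mem_simplex t h).2,
      one_mul]
    simp only [Matrix.mulVec, dotProduct, mul_comm, sub_self]
  have h1 := histLaw_azuma D π hmeas hb (fun t h => (hmean t h).le) hγ hγT hT
  have h2 := histLaw_azuma D π (ξ := fun t h i x => -ξ t h i x) (fun t i => (hmeas t i).neg)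
    (fun t h i x => by rw [abs_neg]; exact hb t h i x)
    (fun t h => by
      simp only [integral_neg, mul_neg, Finset.sum_neg_distrib, hmean t h, neg_zero, le_refl])
    hγ hγT hT
  have hneg : ∀ h : History m d T, pathSum (fun t h i x => -ξ t h i x) h = -pathSum ξ h :=
    fun h => Finset.sum_neg_distrib _
  simp only [hneg] at h2
  have hsub : {h : History m d T | 2 * Real.sqrt (γ * T) < |pathSum ξ h|} ⊆
      {h | 2 * Real.sqrt (γ * T) < pathSum ξ h} ∪ {h | 2 * Real.sqrt (γ * T) < -pathSum ξ h} := by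
    intro h hh
    simpa only [Set.mem_union, Set.mem_ofPred_eq, lt_abs] using hh
  refine (measure_mono hsub).trans ((measure_union_le _ _).trans ((add_le_add h1 h2).trans ?_))
  rw [← ENNReal.ofReal_add (Real.exp_pos _).le (Real.exp_pos _).le, two_mul]

lemma histLaw_not_isTypical_le {γ : ℝ} (hγ : 1 ≤ γ) {T : ℕ} (hγT : γ ≤ T) (hT : 0 < T) :
    histLaw D π T {h | ¬ IsTypical D π γ h} ≤
      ENNReal.ofReal (T * d * m * (2 * (T + 1) * Real.exp (-(γ / 4))) + Real.exp (-γ) +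
        d * (2 * Real.exp (-γ))) := by
  have hγ0 : 0 ≤ γ := by linarith
  let A : Fin T → Fin d → Fin m → Set (History m d T) := fun s j i =>
    {h | meanMatrix D j i ∉ Set.Icc (lcb γ (initialPart s s.isLt.le h) j i)
      (ucb γ (initialPart s s.isLt.le h) j i)}
  let B : Set (History m d T) := {h | 2 * Real.sqrt (γ * T) <
    pathSum (fun t h i _ => ∑ i', π.dist t h i' * width γ h i' - width γ h i) h}
  let C : Fin d → Set (History m d T) := fun j => {h | 2 * Real.sqrt (γ * T) <
    |pathSum (fun t h _ x => (x j : ℝ) - (meanMatrix D).mulVec (π.dist t h) j) h|}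
  have hsub : {h | ¬ IsTypical D π γ h} ⊆ (⋃ s, ⋃ j, ⋃ i, A s j i) ∪ B ∪ ⋃ j, C j := by
    intro h hh
    by_contra hcon
    simp only [A, B, C, Set.mem_union, Set.mem_iUnion, Set.mem_ofPred_eq, not_or, not_exists,
      not_not, not_lt] at hcon
    exact hh ⟨fun s j i => hcon.1.1 s j i, hcon.1.2, hcon.2⟩
  have hA : histLaw D π T (⋃ s, ⋃ j, ⋃ i, A s j i) ≤
      ENNReal.ofReal (T * d * m * (2 * (T + 1) * Real.exp (-(γ / 4)))) := by
    calc _ ≤ ∑ s, ∑ j, ∑ i, histLaw D π T (A s j i) :=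
          (measure_iUnion_fintype_le _ _).trans (Finset.sum_le_sum fun s _ =>
            (measure_iUnion_fintype_le _ _).trans (Finset.sum_le_sum fun j _ =>
              measure_iUnion_fintype_le _ _))
      _ ≤ ∑ _s : Fin T, ∑ _j : Fin d, ∑ _i : Fin m,
          ENNReal.ofReal (2 * (T + 1) * Real.exp (-(γ / 4))) := by
          gcongr with s _ j _ i _
          exact histLaw_notMem_Icc_lcb_ucb_le D π j i hγ s.isLt.le
      _ = _ := by
          simp only [Finset.sum_const, Finset.card_univ, Fintype.card_fin, nsmul_eq_mul,
            ← ENNReal.ofReal_natCast]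
          rw [← ENNReal.ofReal_mul (Nat.cast_nonneg _), ← ENNReal.ofReal_mul (Nat.cast_nonneg _),
            ← ENNReal.ofReal_mul (Nat.cast_nonneg _)]
          congr 1
          ring
  have hB : histLaw D π T B ≤ ENNReal.ofReal (Real.exp (-γ)) :=
    histLaw_lt_pathSum_width_le D π hγ0 hγT hT
  have hC : histLaw D π T (⋃ j, C j) ≤ ENNReal.ofReal (d * (2 * Real.exp (-γ))) := by
    calc _ ≤ ∑ j, histLaw D π T (C j) := measure_iUnion_fintype_le _ _
      _ ≤ ∑ _j : Fin d, ENNReal.ofReal (2 * Real.exp (-γ)) :=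
          Finset.sum_le_sum fun j _ => histLaw_lt_abs_pathSum_obs_le D π j hγ0 hγT hT
      _ = _ := by
          simp only [Finset.sum_const, Finset.card_univ, Fintype.card_fin, nsmul_eq_mul,
            ← ENNReal.ofReal_natCast]
          rw [← ENNReal.ofReal_mul (Nat.cast_nonneg _)]
  refine (measure_mono hsub).trans ((measure_union_le _ _).trans
    ((add_le_add ((measure_union_le _ _).trans (add_le_add hA hB)) hC).trans_eq ?_))
  rw [← ENNReal.ofReal_add (by positivity) (by positivity),
    ← ENNReal.ofReal_add (by positivity) (by positivity)]

/-- With `n = mTd`, the factor `24` makes `exp (-(γ/4)) = (δ/n)^6`. The sum is then at most `7 n²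
(δ/n)^6 = 7 δ² (δ/n)^4`, and `δ/n ≤ 1/2` makes this at most `7 δ²/16 < δ`. -/
lemma failure_prob_le {m T d : ℕ} (hm : 1 ≤ m) (hT : 1 ≤ T) (hd : 1 ≤ d) {δ γ : ℝ}
    (hδ0 : 0 < δ) (hδ1 : δ < 1) (hδ : 2 * δ ≤ (m * T * d : ℝ))
    (hγ : γ = 24 * Real.log (m * T * d / δ)) :
    T * d * m * (2 * (T + 1) * Real.exp (-(γ / 4))) + Real.exp (-γ) +
      d * (2 * Real.exp (-γ)) ≤ δ := by
  have hm' : (1 : ℝ) ≤ m := by exact_mod_cast hm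
  have hT' : (1 : ℝ) ≤ T := by exact_mod_cast hT
  have hd' : (1 : ℝ) ≤ d := by exact_mod_cast hd
  set n : ℝ := m * T * d with hn
  have hTm : (T : ℝ) ≤ m * T := le_mul_of_one_le_left (by positivity) hm'
  have hTn : (T : ℝ) ≤ n := hTm.trans (le_mul_of_one_le_right (by positivity) hd')
  have hdn : (d : ℝ) ≤ n := le_mul_of_one_le_left (by positivity) (hT'.trans hTm)
  have hn1 : 1 ≤ n := hT'.trans hTn
  have hexp : Real.exp (-(γ / 4)) = (δ / n) ^ 6 := by
    rw [hγ, show -(24 * Real.log (n / δ) / 4) = ((6 : ℕ) : ℝ) * Real.log (δ / n) by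
      rw [← inv_div n δ, Real.log_inv]; push_cast; ring, Real.exp_nat_mul,
      Real.exp_log (by positivity)]
  have hγ0 : 0 ≤ γ := by
    rw [hγ]
    have : 0 ≤ Real.log (n / δ) := Real.log_nonneg ((one_le_div hδ0).2 (by linarith))
    linarith
  have hle : Real.exp (-γ) ≤ Real.exp (-(γ / 4)) := Real.exp_le_exp.2 (by linarith)
  have he0 := (Real.exp_pos (-(γ / 4))).le
  set e := Real.exp (-(γ / 4))
  have hsum : T * d * m * (2 * (T + 1) * e) + Real.exp (-γ) + d * (2 * Real.exp (-γ)) ≤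
      7 * n ^ 2 * e := by
    have h1 : T * d * m * (2 * (T + 1) * e) ≤ 4 * n ^ 2 * e := by
      have : T * d * m * (2 * (T + 1) * e) = n * (2 * (T + 1)) * e := by rw [hn]; ring
      rw [this]
      refine mul_le_mul_of_nonneg_right ?_ he0
      nlinarith
    have h2 : Real.exp (-γ) ≤ n ^ 2 * e := hle.trans (le_mul_of_one_le_left he0 (one_le_pow₀ hn1))
    have h3 : d * (2 * Real.exp (-γ)) ≤ 2 * n ^ 2 * e := by
      calc d * (2 * Real.exp (-γ)) ≤ n * (2 * e) := by gcongr
        _ = 2 * n * e := by ring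
        _ ≤ 2 * n ^ 2 * e := by gcongr; exact le_self_pow₀ hn1 two_ne_zero
    linarith
  refine hsum.trans ?_
  rw [hexp]
  have hy0 : 0 ≤ δ / n := by positivity
  have hy : δ / n ≤ 1 / 2 := by rw [div_le_div_iff₀ (by linarith) (by norm_num)]; linarith
  have hpow : (δ / n) ^ 4 ≤ (1 / 2) ^ 4 := by gcongr
  have hδn : 7 * n ^ 2 * (δ / n) ^ 6 = 7 * δ ^ 2 * (δ / n) ^ 4 := by
    field_simp
  rw [hδn]
  nlinarith

end Probability

section Regret

variable {T : ℕ} {D : Fin m → Measure (Obs d)} {π : Policy m d} {γ : ℝ} {h : History m d T}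

lemma abs_sum_smul_mulVec_sub_avgObs_le (hγ : 0 ≤ γ) (hm : 1 ≤ m) (hT : 0 < T)
    (hh : IsTypical D π γ h) {U : Fin T → Matrix (Fin d) (Fin m) ℝ}
    (hU : ∀ s : Fin T, U s ∈ confCube γ (initialPart s s.isLt.le h)) (j : Fin d) :
    |(∑ s : Fin T, (1 / T : ℝ) • (U s).mulVec (π.dist s (initialPart s s.isLt.le h))) j -
      avgObs h j| ≤ 20 * Real.sqrt (γ * m / T) := by
  have hT' : (0 : ℝ) < T := by exact_mod_cast hT
  have h1 := abs_sum_mulVec_sub_obs_le π (meanMatrix D) hγ hm h hh.1 hh.2.1 j (hh.2.2 j) hU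
  have h2 : (∑ s : Fin T, (1 / T : ℝ) • (U s).mulVec (π.dist s (initialPart s s.isLt.le h))) j -
      avgObs h j = (∑ s : Fin T, ((U s).mulVec (π.dist s (initialPart s s.isLt.le h)) j -
        ((h s).2 j : ℝ))) / T := by
    simp only [Finset.sum_apply, Pi.smul_apply, smul_eq_mul, ← Finset.mul_sum,
      Finset.sum_sub_distrib, avgObs]
    ring
  rw [h2, abs_div, abs_of_pos hT', div_le_iff₀ hT']
  refine h1.trans_eq ?_
  rw [show γ * m * T = (γ * m / T) * T ^ 2 by field_simp,
    Real.sqrt_mul (by positivity), Real.sqrt_sq hT'.le, mul_assoc]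

/-- The mean matrix itself witnesses feasibility. In particular the algorithm's problem is feasible
in every round, so the arbitrary choice never occurs. -/
lemma mem_feasible_of_isTypical {q : ℝ≥0∞} [Fact (1 ≤ q)] {S : Set (Fin d → ℝ)}
    (hS : S.Nonempty) (hh : IsTypical D π γ h) {p : Fin m → ℝ} (hp : p ∈ stdSimplex ℝ (Fin m))
    (hpS : (meanMatrix D).mulVec p ∈ closure S) (s : Fin T) :
    p ∈ feasible q γ S (initialPart s s.isLt.le h) :=
  ⟨hp, meanMatrix D, hh.1 s, (lqDist_nonpos_iff q hS).2 hpS⟩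

lemma objective_sub_le_of_isTypical {q₁ q₂ : ℝ≥0∞} [Fact (1 ≤ q₁)] [Fact (1 ≤ q₂)]
    {f : (Fin d → ℝ) → ℝ} {L : ℝ} {S : Set (Fin d → ℝ)} (hf : ConcaveOn ℝ (cube d) f)
    (hL : ∀ x ∈ cube d, ∀ y ∈ cube d, f x - f y ≤ L * lqNorm q₁ (x - y)) (hL0 : 0 ≤ L)
    (hS : S.Nonempty) (hγ : 0 ≤ γ) (hm : 1 ≤ m) (hT : 0 < T) (hπ : IsUCBPolicy q₂ γ f S T π)
    (hh : IsTypical D π γ h) {p : Fin m → ℝ} (hp : p ∈ stdSimplex ℝ (Fin m))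
    (hpS : (meanMatrix D).mulVec p ∈ closure S) :
    f ((meanMatrix D).mulVec p) - f (avgObs h) ≤
      20 * (L * lqNorm q₁ (1 : Fin d → ℝ) * Real.sqrt (γ * m / T)) := by
  have hT' : (0 : ℝ) < T := by exact_mod_cast hT
  have hfeas := mem_feasible_of_isTypical (q := q₂) hS hh hp hpS
  choose U hU hopt using fun s : Fin T => (hπ s s.isLt _ ⟨p, hfeas s⟩).2
  have hcube : ∀ s : Fin T,
      (U s).mulVec (π.dist s (initialPart s s.isLt.le h)) ∈ cube d := fun s =>
    mulVec_mem_cube_of_mem_confCube (hU s) (π.mem_simplex _ _)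
  have hw : ∑ _s : Fin T, (1 / T : ℝ) = 1 := by simp; field_simp
  have hw0 : ∀ s ∈ (Finset.univ : Finset (Fin T)), (0 : ℝ) ≤ 1 / T := fun _ _ => by positivity
  have h1 := hf.le_map_sum hw0 hw fun s _ => hcube s
  have h2 : f ((meanMatrix D).mulVec p) ≤ ∑ s : Fin T,
      (1 / T : ℝ) • f ((U s).mulVec (π.dist s (initialPart s s.isLt.le h))) := by
    calc f ((meanMatrix D).mulVec p)
        = ∑ _s : Fin T, (1 / T : ℝ) • f ((meanMatrix D).mulVec p) := by
          rw [← Finset.sum_smul, hw, one_smul]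
      _ ≤ _ := Finset.sum_le_sum fun s _ => smul_le_smul_of_nonneg_left
          (hopt s p (hfeas s) _ (hh.1 s)) (hw0 s (Finset.mem_univ s))
  have h3 := sub_le_of_abs_le hL hL0 (hf.1.sum_mem hw0 hw fun s _ => hcube s)
    (avgObs_mem_cube hT h) (by positivity) (abs_sum_smul_mulVec_sub_avgObs_le hγ hm hT hh hU)
  linarith

/-- The feasibility witnesses of all rounds average to a point of `closure S`, which is close to the
average observation. -/
lemma regretCon_le_of_isTypical {q : ℝ≥0∞} [Fact (1 ≤ q)]
    {f : (Fin d → ℝ) → ℝ} {S : Set (Fin d → ℝ)} (hSc : Convex ℝ S)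
    (hS : S.Nonempty) (hγ : 0 ≤ γ) (hm : 1 ≤ m) (hT : 0 < T) (hπ : IsUCBPolicy q γ f S T π)
    (hh : IsTypical D π γ h) {p : Fin m → ℝ} (hp : p ∈ stdSimplex ℝ (Fin m))
    (hpS : (meanMatrix D).mulVec p ∈ closure S) :
    regretCon q S h ≤ 20 * (lqNorm q (1 : Fin d → ℝ) * Real.sqrt (γ * m / T)) := by
  have hT' : (0 : ℝ) < T := by exact_mod_cast hT
  have hfeas := mem_feasible_of_isTypical (q := q) hS hh hp hpS
  choose U hU hopt using fun s : Fin T => (hπ s s.isLt _ ⟨p, hfeas s⟩).1.2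
  have hw : ∑ _s : Fin T, (1 / T : ℝ) = 1 := by simp; field_simp
  have hmem := hSc.closure.sum_mem (fun _ _ => by positivity) hw fun s _ =>
    (lqDist_nonpos_iff q hS).1 (hopt s)
  refine (lqDist_le q hmem).trans ((lqNorm_le_of_abs_le q (by positivity) fun j => ?_).trans_eq
    (show 20 * Real.sqrt (γ * m / T) * _ = _ by ring))
  rw [Pi.sub_apply, abs_sub_comm]
  exact abs_sum_smul_mulVec_sub_avgObs_le hγ hm hT hh hU j

end Regret

lemma abs_sub_le_one_of_mem_cube {x y : Fin d → ℝ} (hx : x ∈ cube d) (hy : y ∈ cube d)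
    (j : Fin d) : |x j - y j| ≤ 1 := by
  have h1 : 0 ≤ x j := hx.1 j
  have h2 : x j ≤ 1 := hx.2 j
  have h3 : 0 ≤ y j := hy.1 j
  have h4 : y j ≤ 1 := hy.2 j
  rw [abs_le]
  constructor <;> linarith

end

end BwCR

end

theorem theorem1 :
    ∃ c > (0 : ℝ), ∃ C > (0 : ℝ),
      ∀ (m d T : ℕ) (q₁ q₂ : ℝ≥0∞) [Fact (1 ≤ q₁)] [Fact (1 ≤ q₂)]
        -- the unknown distributions of the arms
        (D : Fin m → Measure (BwCR.Obs d)) [∀ i, IsProbabilityMeasure (D i)]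
        -- the objective and the constraint set
        (f : (Fin d → ℝ) → ℝ) (L : ℝ) (S : Set (Fin d → ℝ)),
        (∀ x ∈ BwCR.cube d, f x ∈ Set.Icc (0 : ℝ) 1) →
        ConcaveOn ℝ (BwCR.cube d) f →
        (∀ x ∈ BwCR.cube d, ∀ y ∈ BwCR.cube d, f x - f y ≤ L * BwCR.lqNorm q₁ (x - y)) →
        Convex ℝ S →
        -- the benchmark problem is feasible
        (∃ p ∈ stdSimplex ℝ (Fin m), (BwCR.meanMatrix D).mulVec p ∈ S) →
        ∀ δ : ℝ, 0 < δ → δ < 1 → 2 * δ ≤ (m * T * d : ℝ) →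
        ∀ γ : ℝ, γ = c * Real.log (m * T * d / δ) →
        ∀ π : BwCR.Policy m d, BwCR.IsUCBPolicy q₂ γ f S T π →
          ENNReal.ofReal (1 - δ) ≤ BwCR.histLaw D π T
            {h | BwCR.regretObj D f S h
                  ≤ C * (L * BwCR.lqNorm q₁ (1 : Fin d → ℝ) * Real.sqrt (γ * m / T)) ∧
                (∀ p ∈ stdSimplex ℝ (Fin m), (BwCR.meanMatrix D).mulVec p ∈ S →
                  f ((BwCR.meanMatrix D).mulVec p) - f (BwCR.avgObs h)
                    ≤ C * (L * BwCR.lqNorm q₁ (1 : Fin d → ℝ) * Real.sqrt (γ * m / T))) ∧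
                BwCR.regretCon q₂ S h
                  ≤ C * (BwCR.lqNorm q₂ (1 : Fin d → ℝ) * Real.sqrt (γ * m / T))} := by
  refine ⟨24, by norm_num, 20, by norm_num, ?_⟩
  intro m d T q₁ q₂ _ _ D _ f L S hf01 hf hL hS ⟨p₀, hp₀, hp₀S⟩ δ hδ0 hδ1 hδ γ hγ π hπ
  have hn : (0 : ℝ) < ((m * T * d : ℕ) : ℝ) := by push_cast; linarith
  have hn' : 0 < m * T * d := by exact_mod_cast hn
  have hm : 1 ≤ m := Nat.pos_of_ne_zero (by rintro rfl; simp at hn')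
  have hT : 0 < T := Nat.pos_of_ne_zero (by rintro rfl; simp at hn')
  have hd : 1 ≤ d := Nat.pos_of_ne_zero (by rintro rfl; simp at hn')
  have hT' : (0 : ℝ) < T := by exact_mod_cast hT
  have hm' : (1 : ℝ) ≤ m := by exact_mod_cast hm
  have hL0 : 0 ≤ L := BwCR.lipschitz_const_nonneg hL hd
  have hfc := BwCR.continuousOn_cube hL hL0
  have hq₁ := BwCR.lqNorm_nonneg q₁ (1 : Fin d → ℝ)
  have hq₂ := BwCR.lqNorm_nonneg q₂ (1 : Fin d → ℝ)
  have hSne : S.Nonempty := ⟨_, hp₀S⟩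
  have hγ1 : 1 ≤ γ := by
    have h1 : Real.log 2 ≤ Real.log (m * T * d / δ) :=
      Real.log_le_log (by norm_num) ((le_div_iff₀ hδ0).2 hδ)
    have h2 := Real.log_two_gt_d9
    rw [hγ]
    linarith
  have hγ0 : 0 ≤ γ := by linarith
  -- Fixed distributions are compared over `closure S`, not `S`, because `optValue_le` only places
  -- the mean of a policy there.
  have hobjOfPoint : ∀ h : BwCR.History m d T,
      (∀ p ∈ stdSimplex ℝ (Fin m), (BwCR.meanMatrix D).mulVec p ∈ closure S →
        f ((BwCR.meanMatrix D).mulVec p) - f (BwCR.avgObs h)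
          ≤ 20 * (L * BwCR.lqNorm q₁ (1 : Fin d → ℝ) * Real.sqrt (γ * m / T))) →
      BwCR.regretObj D f S h
        ≤ 20 * (L * BwCR.lqNorm q₁ (1 : Fin d → ℝ) * Real.sqrt (γ * m / T)) := by
    intro h hh
    have hf0 := (hf01 _ (BwCR.avgObs_mem_cube hT h)).1
    rw [BwCR.regretObj, sub_le_iff_le_add]
    refine BwCR.optValue_le D hf hf01 hfc hS hT (by positivity) fun p hp hpS => ?_
    linarith [hh p hp hpS]
  -- Azuma's inequality needs `γ ≤ T`. In the other case the bounds hold for every history, because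
  -- two points of the cube differ by at most `1` in each coordinate.
  by_cases hγT : γ * m ≤ T
  · have hγT' : γ ≤ T := (le_mul_of_one_le_right hγ0 hm').trans hγT
    have hbad := (BwCR.histLaw_not_isTypical_le D π hγ1 hγT' hT).trans
      (ENNReal.ofReal_le_ofReal (BwCR.failure_prob_le hm hT hd hδ0 hδ1 hδ hγ))
    have hgood : ENNReal.ofReal (1 - δ) ≤ BwCR.histLaw D π T {h | BwCR.IsTypical D π γ h} := by
      -- Subadditivity replaces passing to the complement, so measurability of the typical event is
      -- not needed.
      rw [ENNReal.ofReal_sub _ hδ0.le, ENNReal.ofReal_one, tsub_le_iff_right]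
      calc 1 = BwCR.histLaw D π T Set.univ := measure_univ.symm
        _ ≤ BwCR.histLaw D π T {h | BwCR.IsTypical D π γ h} +
            BwCR.histLaw D π T {h | ¬ BwCR.IsTypical D π γ h} := by
            refine (measure_mono fun h _ => ?_).trans (measure_union_le _ _)
            exact em (BwCR.IsTypical D π γ h)
        _ ≤ _ := by gcongr
    refine hgood.trans (measure_mono fun h hh => ?_)
    have hobj := fun p hp hpS => BwCR.objective_sub_le_of_isTypical (p := p) hf hL hL0 hSne hγ0
      hm hT hπ hh hp hpS
    exact ⟨hobjOfPoint h hobj, fun p hp hpS => hobj p hp (subset_closure hpS),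
      BwCR.regretCon_le_of_isTypical hS hSne hγ0 hm hT hπ hh hp₀ (subset_closure hp₀S)⟩
  · have hone : 1 ≤ 20 * Real.sqrt (γ * m / T) := by
      have : 1 ≤ Real.sqrt (γ * m / T) :=
        Real.one_le_sqrt.2 ((one_le_div hT').2 (le_of_not_ge hγT))
      linarith
    have hall : ∀ h : BwCR.History m d T, h ∈ {h : BwCR.History m d T | BwCR.regretObj D f S h
          ≤ 20 * (L * BwCR.lqNorm q₁ (1 : Fin d → ℝ) * Real.sqrt (γ * m / T)) ∧
        (∀ p ∈ stdSimplex ℝ (Fin m), (BwCR.meanMatrix D).mulVec p ∈ S →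
          f ((BwCR.meanMatrix D).mulVec p) - f (BwCR.avgObs h)
            ≤ 20 * (L * BwCR.lqNorm q₁ (1 : Fin d → ℝ) * Real.sqrt (γ * m / T))) ∧
        BwCR.regretCon q₂ S h
          ≤ 20 * (BwCR.lqNorm q₂ (1 : Fin d → ℝ) * Real.sqrt (γ * m / T))} := by
      intro h
      have havg := BwCR.avgObs_mem_cube hT h
      have hobj : ∀ p ∈ stdSimplex ℝ (Fin m), f ((BwCR.meanMatrix D).mulVec p) -
          f (BwCR.avgObs h) ≤
            20 * (L * BwCR.lqNorm q₁ (1 : Fin d → ℝ) * Real.sqrt (γ * m / T)) := by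
        intro p hp
        have hV := BwCR.meanMatrix_mulVec_mem_cube D hp
        refine (BwCR.sub_le_of_abs_le hL hL0 hV havg zero_le_one
          (BwCR.abs_sub_le_one_of_mem_cube hV havg)).trans ?_
        nlinarith [mul_nonneg hL0 hq₁]
      refine ⟨hobjOfPoint h fun p hp _ => hobj p hp, fun p hp _ => hobj p hp, ?_⟩
      refine (BwCR.lqDist_le q₂ (subset_closure hp₀S)).trans
        ((BwCR.lqNorm_le_of_abs_le q₂ zero_le_one (BwCR.abs_sub_le_one_of_mem_cube havg
          (BwCR.meanMatrix_mulVec_mem_cube D hp₀))).trans ?_)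
      nlinarith
    rw [Set.eq_univ_of_forall hall, measure_univ]
    exact ENNReal.ofReal_le_one.2 (by linarith)
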